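/- **Setting.** Let $V,H$ be real Hilbert spaces with $V\subset H=H'\subset V'$, $V$ densely and continuously embedded in $H$, $\langle\cdot,\cdot\rangle$ the inner product of $H$ and the pairing of $V'$ and $V$. Let $\mathcal L:V\to V'$ be linear, bounded, self-adjoint and positive definite (coercive), $\|v\|_H=\langle v,v\rangle^{1/2}$, $\|v\|_V=\langle\mathcal Lv,v\rangle^{1/2}$, $\|f\|_\star=\sup_{w\in V\setminus\{0\}}|\langle f,w\rangle|/\|w\|_V$ for $f\in V'$. Let $\varpi,T>0$, $\mathcal F:V\to V'$, $k\ge1$, and let $u:[0,T]\to V$ satisfy $u_t+\varpi\mathcal Lu=\mathcal F(u)$ in $V'$ for $0<t<T$, with $u\in C^k([0,T];V)\cap C^{k+1}([0,T];V')$. Assume that for constants $\mu_0\ge0$ and $\mu_1\in\mathbb R$ $$\|\mathcal F(v)-\mathcal F(w)\|_\star\le\mu_0\|v-w\|_V+\mu_1\|v-w\|_H$$ whenever $t\in[0,T]$, $v,w\in V$, $\|v-u(t)\|_V\le1$ and $\|w-u(t)\|_V\le1$. **Method.** Let $a_0,\dots,a_{k-1}$, $b_0,\dots,b_k$, $c_0,\dots,c_{k-1}$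 be real with $a_0,b_0,c_0>0$. For $\tau=T/N$, $t_n=n\tau$, $\partial_\tau v^n=(v^n-v^{n-1})/\tau$ and correction terms $\mathfrak C_n\in V'$ ($1\le n<k$; $\mathfrak C_n=0$ for $n\ge k$), the residual of $(v^n)_{0\le n\le N}\subset V$ at step $1\le n\le N$ is $$\rho_n(v)=\sum_{j=0}^{k-1}a_j\partial_\tau v^{n-j}+\varpi\sum_{j=0}^{k}b_j\mathcal Lv^{n-j}-\sum_{j=0}^{k-1}c_j\mathcal F(v^{n-j-1})-\mathfrak C_n,$$ where terms involving negative time indices are dropped. A numerical solution is a sequence $(u^n)_{0\le n\le N}\subset V$ with $u^0=u(0)$ and $\rho_n(u^\cdot)=0$ for $1\le n\le N$. Assume: 1. (zero-stability) all roots of $(\zeta-1)\sum_{j=0}^{k-1}a_j\zeta^{k-1-j}$ lie in $|\zeta|\le1$ and those with $|\zeta|=1$ are simple; 2. (order $k$) $\sum_{j=0}^{k-1}a_j=1$ and $\sum_{j=0}^{k-1}a_j\partial_\tau t_{n-j}^\ell=\ell\sum_{j=0}^{k}b_jt_{n-j}^{\ell-1}=\ell\sum_{j=0}^{k-1}c_jt_{n-j-1}^{\ell-1}$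 for $1\le\ell\le k$, $n\ge k$, $\tau>0$; 3. with $a(\theta)=\sum_{j=0}^{k-1}a_je^{\mathrm ij\theta}$, $b(\theta)=\sum_{j=0}^{k}b_je^{\mathrm ij\theta}$, $c(\theta)=\sum_{j=0}^{k-1}c_je^{\mathrm ij\theta}$, the quantities $$\sigma_F=\max_{\theta\in[0,2\pi)}\Big|\frac1{a(\theta)}\Big|,\quad\sigma_E=\max_{\theta\in[0,2\pi)}\Big|\frac{c(\theta)}{a(\theta)}\Big|,\quad\lambda_I=\min_{\theta\in[0,2\pi)}\Re\frac{b(\theta)}{a(\theta)}$$ are finite (so $a(\theta)\neq0$ for all $\theta$) and positive; 4. the starting steps are consistent of order $k$: $\|\rho_n(u(t_\cdot))\|_\star\le K_c\tau^k$ for $1\le n<k$, $n\le N$, with $K_c$ independent of $\tau$. **Theorem.** If $\lambda_I/\sigma_E>\mu_0/\varpi$, then $\varepsilon:=\frac12-\frac{(\sigma_E\mu_0)^2}{2(\lambda_I\varpi)^2}>0$, and there are positive constants $K,\tau_0,\delta$, depending on the data, on $u$ and on $K_c$, but not on $N$, $\tau$, the correction terms or the numerical solution, such that for every $\tau=T/N\le\tau_0$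 every numerical solution $(u^n)$ satisfies, for $0\le n\le N$: * (stability) $\|u(t_n)-u^n\|_V\le1$. Moreover, if $(v^n)_{0\le n\le N}\subset V$ satisfies the perturbed scheme $\rho_n(v)=d_n\in V'$ for $1\le n\le N$ and $P_N\le\delta\tau$, where $P_n:=\|v^0-u^0\|_H^2+\tau\|v^0-u^0\|_V^2+\sum_{i=1}^n\tau\|d_i\|_\star^2$, then $\|u(t_n)-v^n\|_V\le1$ and $$\|v^n-u^n\|_H^2+\varepsilon\lambda_I\varpi\sum_{j=1}^n\tau\|v^j-u^j\|_V^2\le K\,P_n;$$ * (convergence of order $k$) $$\|u(t_n)-u^n\|_H^2+\varepsilon\lambda_I\varpi\sum_{j=1}^n\tau\|u(t_j)-u^j\|_V^2\le K\tau^{2k}.$$ -/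

import Mathlib

open scoped BigOperators

noncomputable section

/-! ### The functional setting: `V ⊂ H = H' ⊂ V'`

`V'` is `StrongDual ℝ V`, the duality pairing of `f : V'` with `v : V` is `f v`, and `ι : V →L[ℝ] H`
is the embedding of `V` into `H`. -/

/-- The inclusion `V → H = H' → V'`: the element `v` of `V` acts on `V` by `w ↦ ⟪ι v, ι w⟫_H`. -/
def toDualV {V H : Type*} [NormedAddCommGroup V] [InnerProductSpace ℝ V]
    [NormedAddCommGroup H] [InnerProductSpace ℝ H] (ι : V →L[ℝ] H) (v : V) : StrongDual ℝ V :=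
  (innerSL ℝ (ι v)).comp ι

/-- The norm `‖v‖_V = ⟨L v, v⟩^{1/2}` on `V`. -/
def energyNorm {V : Type*} [NormedAddCommGroup V] [InnerProductSpace ℝ V]
    (L : V →L[ℝ] StrongDual ℝ V) (v : V) : ℝ :=
  Real.sqrt (L v v)

/-- The dual norm `‖f‖_⋆ = sup_{w ≠ 0} |⟨f, w⟩| / ‖w‖_V` on `V'`. -/
def dualNorm {V : Type*} [NormedAddCommGroup V] [InnerProductSpace ℝ V]
    (L : V →L[ℝ] StrongDual ℝ V) (f : StrongDual ℝ V) : ℝ :=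
  ⨆ w : {w : V // w ≠ 0}, |f w| / energyNorm L w

/-- `L : V → V'` is a positive definite, self-adjoint operator. Positive definiteness is
coercivity, that is, `⟨L v, v⟩^{1/2}` is an equivalent norm on `V`. -/
structure IsPosDefSelfAdjoint {V : Type*} [NormedAddCommGroup V] [InnerProductSpace ℝ V]
    (L : V →L[ℝ] StrongDual ℝ V) : Prop where
  symm : ∀ v w : V, L v w = L w v
  coercive : ∃ α : ℝ, 0 < α ∧ ∀ v : V, α * ‖v‖ ^ 2 ≤ L v v

/-- The local Lipschitz condition with constants `μ₀`, `μ₁` in the closed unit balls of the norm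
`‖·‖_V` around the values `u t`, `t ∈ [0, T]`. -/
def LocalLipschitz {V H : Type*} [NormedAddCommGroup V] [InnerProductSpace ℝ V]
    [NormedAddCommGroup H] [InnerProductSpace ℝ H] (ι : V →L[ℝ] H)
    (L : V →L[ℝ] StrongDual ℝ V) (F : V → StrongDual ℝ V) (u : ℝ → V) (T μ₀ μ₁ : ℝ) : Prop :=
  ∀ t ∈ Set.Icc (0 : ℝ) T, ∀ v w : V, energyNorm L (v - u t) ≤ 1 → energyNorm L (w - u t) ≤ 1 →
    dualNorm L (F v - F w) ≤ μ₀ * energyNorm L (v - w) + μ₁ * ‖ι (v - w)‖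

/-- `u` is a solution on `[0, T]` of `u_t + ϖ L u = F(u)`, an equation in `V'` for `0 < t < T`,
which is regular enough for consistency of order `k`:
`u ∈ C^k([0, T]; V)` and `u ∈ C^{k+1}([0, T]; V')`. -/
structure IsRegularSolution {V H : Type*} [NormedAddCommGroup V] [InnerProductSpace ℝ V]
    [NormedAddCommGroup H] [InnerProductSpace ℝ H] (ι : V →L[ℝ] H)
    (L : V →L[ℝ] StrongDual ℝ V) (F : V → StrongDual ℝ V) (ϖ T : ℝ) (k : ℕ) (u : ℝ → V) :
    Prop where
  equation : ∀ t ∈ Set.Ioo (0 : ℝ) T,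
    HasDerivAt (fun s => toDualV ι (u s)) (F (u t) - ϖ • L (u t)) t
  regular_V : ContDiffOn ℝ (k : ℕ) u (Set.Icc 0 T)
  regular_dual : ContDiffOn ℝ ((k + 1 : ℕ)) (fun t => toDualV ι (u t)) (Set.Icc 0 T)

/-! ### Implicit-explicit multistep methods -/

/-- The coefficients of a `k`-step method: `a 0, …, a (k-1)`, `b 0, …, b k` and
`c 0, …, c (k-1)`; other values are never used. -/
structure IEMS (k : ℕ) where
  a : ℕ → ℝ
  b : ℕ → ℝ
  c : ℕ → ℝ
  a_pos : 0 < a 0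
  b_pos : 0 < b 0
  c_pos : 0 < c 0

namespace IEMS

variable {k : ℕ}

/-- The semi-generating function `a(θ) = ∑_{j<k} a_j e^{ijθ}`. -/
def aGen (S : IEMS k) (θ : ℝ) : ℂ :=
  ∑ j ∈ Finset.range k, (S.a j : ℂ) * Complex.exp (Complex.I * j * θ)

/-- The semi-generating function `b(θ) = ∑_{j≤k} b_j e^{ijθ}`. -/
def bGen (S : IEMS k) (θ : ℝ) : ℂ :=
  ∑ j ∈ Finset.range (k + 1), (S.b j : ℂ) * Complex.exp (Complex.I * j * θ)

/-- The semi-generating function `c(θ) = ∑_{j<k} c_j e^{ijθ}`. -/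
def cGen (S : IEMS k) (θ : ℝ) : ℂ :=
  ∑ j ∈ Finset.range k, (S.c j : ℂ) * Complex.exp (Complex.I * j * θ)

/-- The first characteristic polynomial `(ζ - 1) ∑_{j<k} a_j ζ^{k-1-j}`. -/
def charPolyA (S : IEMS k) : Polynomial ℂ :=
  (Polynomial.X - 1) *
    ∑ j ∈ Finset.range k, Polynomial.C (S.a j : ℂ) * Polynomial.X ^ (k - 1 - j)

/-- Zero-stability: the root condition for the first characteristic polynomial. -/
def ZeroStable (S : IEMS k) : Prop :=
  ∀ ζ : ℂ, S.charPolyA.IsRoot ζ →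
    ‖ζ‖ ≤ 1 ∧ (‖ζ‖ = 1 → S.charPolyA.rootMultiplicity ζ = 1)

/-- The quantities `σ_F = max |1/a|`, `σ_E = max |c/a|` and `λ_I = min Re (b/a)` over
`θ ∈ [0, 2π)` exist as finite positive numbers; the quotients are genuine. -/
structure HasIntensities (S : IEMS k) (σF σE lamI : ℝ) : Prop where
  aGen_ne_zero : ∀ θ : ℝ, S.aGen θ ≠ 0
  isGreatest_F : IsGreatest ((fun θ : ℝ => ‖1 / S.aGen θ‖) '' Set.Ico 0 (2 * Real.pi)) σF
  isGreatest_E :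
    IsGreatest ((fun θ : ℝ => ‖S.cGen θ / S.aGen θ‖) '' Set.Ico 0 (2 * Real.pi)) σE
  isLeast_I : IsLeast ((fun θ : ℝ => (S.bGen θ / S.aGen θ).re) '' Set.Ico 0 (2 * Real.pi)) lamI
  F_pos : 0 < σF
  E_pos : 0 < σE
  I_pos : 0 < lamI

/-- The order conditions up to `q` on the uniform mesh `t_m = m τ`:
`∑ a_j = 1` and `∑ a_j ∂_τ t_{n-j}^ℓ = ℓ ∑ b_j t_{n-j}^{ℓ-1} = ℓ ∑ c_j t_{n-j-1}^{ℓ-1}`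
for `1 ≤ ℓ ≤ q`. -/
structure OrderConditions (S : IEMS k) (q : ℕ) : Prop where
  sum_a : ∑ j ∈ Finset.range k, S.a j = 1
  implicit_part : ∀ τ : ℝ, 0 < τ → ∀ n : ℕ, k ≤ n → ∀ l : ℕ, 1 ≤ l → l ≤ q →
    ∑ j ∈ Finset.range k,
        S.a j * (((((n : ℝ) - j) * τ) ^ l - (((n : ℝ) - j - 1) * τ) ^ l) / τ) =
      l * ∑ j ∈ Finset.range (k + 1), S.b j * (((n : ℝ) - j) * τ) ^ (l - 1)
  explicit_part : ∀ τ : ℝ, 0 < τ → ∀ n : ℕ, k ≤ n → ∀ l : ℕ, 1 ≤ l → l ≤ q →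
    ∑ j ∈ Finset.range k,
        S.a j * (((((n : ℝ) - j) * τ) ^ l - (((n : ℝ) - j - 1) * τ) ^ l) / τ) =
      l * ∑ j ∈ Finset.range k, S.c j * (((n : ℝ) - j - 1) * τ) ^ (l - 1)

/-- The residual in `V'` of the scheme at step `n ≥ 1` for a sequence `v 0, v 1, …` in `V`,
`∑_{j<k} a_j ∂_τ v^{n-j} + ϖ ∑_{j≤k} b_j L v^{n-j} - ∑_{j<k} c_j F(v^{n-j-1}) - corr_n`.
Terms with a negative time index, which occur only in the starting steps `n < k`, are dropped.
The correction terms `corr n` enter for `n < k` only. -/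
def residual {V H : Type*} [NormedAddCommGroup V] [InnerProductSpace ℝ V]
    [NormedAddCommGroup H] [InnerProductSpace ℝ H] (S : IEMS k) (ι : V →L[ℝ] H)
    (L : V →L[ℝ] StrongDual ℝ V) (F : V → StrongDual ℝ V) (ϖ τ : ℝ)
    (corr : ℕ → StrongDual ℝ V) (v : ℕ → V) (n : ℕ) : StrongDual ℝ V :=
  (∑ j ∈ (Finset.range k).filter (fun j => j < n),
      S.a j • (τ⁻¹ • (toDualV ι (v (n - j)) - toDualV ι (v (n - j - 1)))))
    + ϖ • (∑ j ∈ (Finset.range (k + 1)).filter (fun j => j ≤ n), S.b j • L (v (n - j)))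
    - (∑ j ∈ (Finset.range k).filter (fun j => j < n), S.c j • F (v (n - j - 1)))
    - (if n < k then corr n else 0)

end IEMS

/-- The number `ε = 1/2 - (σ_E μ₀)² / (2 (λ_I ϖ)²)`. -/
def stabilityMargin (ϖ μ₀ σE lamI : ℝ) : ℝ :=
  1 / 2 - (σE * μ₀) ^ 2 / (2 * (lamI * ϖ) ^ 2)

/-- The discrete energy `‖e^n‖_H² + ε λ_I ϖ ∑_{j=1}^n τ ‖e^j‖_V²` of a sequence `e` in `V`. -/
def discreteEnergy {V H : Type*} [NormedAddCommGroup V] [InnerProductSpace ℝ V]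
    [NormedAddCommGroup H] [InnerProductSpace ℝ H] (ι : V →L[ℝ] H)
    (L : V →L[ℝ] StrongDual ℝ V) (ε lamI ϖ τ : ℝ) (e : ℕ → V) (n : ℕ) : ℝ :=
  ‖ι (e n)‖ ^ 2 + ε * lamI * ϖ * ∑ j ∈ Finset.Icc 1 n, τ * energyNorm L (e j) ^ 2

/-- The size `‖e^0‖_H² + τ ‖e^0‖_V² + ∑_{i=1}^n τ ‖d_i‖_⋆²` of a perturbation consisting of `e0`
in the initial value and of `d i` in the `i`-th step of the scheme. -/
def perturbationSize {V H : Type*} [NormedAddCommGroup V] [InnerProductSpace ℝ V]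
    [NormedAddCommGroup H] [InnerProductSpace ℝ H] (ι : V →L[ℝ] H)
    (L : V →L[ℝ] StrongDual ℝ V) (τ : ℝ) (e0 : V) (d : ℕ → StrongDual ℝ V) (n : ℕ) : ℝ :=
  ‖ι e0‖ ^ 2 + τ * energyNorm L e0 ^ 2 + ∑ i ∈ Finset.Icc 1 n, τ * dualNorm L (d i) ^ 2

end

/-! The difference $e$ of two sequences satisfies, after subtraction of the schemes, a linear
recursion $\alpha * \partial_\tau e + \varpi\,\beta * Le = \gamma * g + d$. Here $*$ is discrete
convolution, $\alpha,\beta,\gamma$ are the generating polynomials of $a,b,c$, and $g$ collects the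
differences of $\mathcal F$ at the preceding index. Zero-stability and $a(\theta)\ne0$ keep the
zeros of $\alpha$ out of the closed unit disc. Hence $1/\alpha$ is a power series with coefficients
tending to zero (`exists_inverse_tendsto_zero`), and convolving with it leaves $\partial_\tau e$
alone on the left.

Testing with $e^n$ and summing makes $\partial_\tau e$ telescope in $H$. By Parseval, the remaining
convolutions are controlled by their symbols on the unit circle: $\beta/\alpha$ is coercive with
constant $\lambda_I$ (`coercive_seqConv_div`), while $\gamma/\alpha$ and $1/\alpha$ are bounded on
$\ell^2$ by $\sigma_E$ and $\sigma_F$ (`bounded_seqConv_div`). Young's inequality absorbs the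
$\mu_0$ part of the nonlinearity and leaves the margin $\varepsilon$. The $\mu_1$ part involves only
earlier $H$-norms and is removed by Gronwall's inequality. This yields
`IEMS.exists_stability_constant`.

Consistency is Taylor expansion: since $\mathcal F(u)=u_t+\varpi\mathcal Lu$, the residual of $u$
splits into two quadrature errors, for $u$ in $V'$ and for $\mathcal F(u)$, both of order $k$
(`IEMS.OrderConditions.exists_residual_bound`). Convergence is then stability applied to
$v^n=u(t_n)$.

The Lipschitz condition is only local. As $\mathcal F$ is evaluated at past values only, induction
on $n$ suffices: the estimate at step $n$ needs the ball condition for $j<n$, and it returns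
$\tau\|e^n\|_V^2\lesssim\tau^{2k}$, which is small after division by $\tau$. -/

/-! ### Convolution of a real power series with a sequence of vectors -/

/-- The convolution `∑_{i+j=n} p_i y_j` of a power series with a sequence in a module. -/
noncomputable def seqConv {M : Type*} [AddCommGroup M] [Module ℝ M] (p : PowerSeries ℝ) (y : ℕ → M)
    (n : ℕ) : M :=
  ∑ x ∈ Finset.HasAntidiagonal.antidiagonal n, PowerSeries.coeff x.1 p • y x.2

section seqConv

variable {M M' : Type*} [AddCommGroup M] [Module ℝ M] [AddCommGroup M'] [Module ℝ M']

/-- Power series act on sequences as a ring, so convolution with $1/\alpha$ undoes convolution with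
$\alpha$. -/
theorem seqConv_mul (p q : PowerSeries ℝ) (y : ℕ → M) (n : ℕ) :
    seqConv (p * q) y n = seqConv p (seqConv q y) n := by
  simp only [seqConv, PowerSeries.coeff_mul, Finset.sum_smul, Finset.smul_sum, smul_smul]
  rw [Finset.sum_sigma', Finset.sum_sigma']
  refine Finset.sum_nbij' (fun x => ⟨(x.2.1, x.2.2 + x.1.2), (x.2.2, x.1.2)⟩)
    (fun x => ⟨(x.1.1 + x.2.1, x.2.2), (x.1.1, x.2.1)⟩) ?_ ?_ ?_ ?_ ?_
  · rintro ⟨⟨a, b⟩, ⟨c, d⟩⟩ h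
    simp only [Finset.mem_sigma, Finset.HasAntidiagonal.mem_antidiagonal, and_true] at h ⊢
    omega
  · rintro ⟨⟨a, b⟩, ⟨c, d⟩⟩ h
    simp only [Finset.mem_sigma, Finset.HasAntidiagonal.mem_antidiagonal, and_true] at h ⊢
    omega
  · rintro ⟨⟨a, b⟩, ⟨c, d⟩⟩ h
    simp only [Finset.mem_sigma, Finset.HasAntidiagonal.mem_antidiagonal] at h
    obtain ⟨h1, h2⟩ := h
    subst h2
    rfl
  · rintro ⟨⟨a, b⟩, ⟨c, d⟩⟩ h
    simp only [Finset.mem_sigma, Finset.HasAntidiagonal.mem_antidiagonal] at h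
    obtain ⟨h1, h2⟩ := h
    subst h2
    rfl
  · rintro ⟨⟨a, b⟩, ⟨c, d⟩⟩ h
    rfl

theorem seqConv_one (y : ℕ → M) (n : ℕ) : seqConv 1 y n = y n := by
  unfold seqConv
  rw [Finset.sum_eq_single (0, n)]
  · simp
  · rintro ⟨a, b⟩ h hne
    have : a ≠ 0 := by
      rintro rfl
      simp at h
      simp [h] at hne
    simp [PowerSeries.coeff_one, this]
  · simp

/-- Causality: convolution is lower triangular. Equations known only up to a final index can
therefore still be convolved with an infinite series. -/
theorem seqConv_congr {p : PowerSeries ℝ} {y z : ℕ → M} {n : ℕ} (h : ∀ j ≤ n, y j = z j) :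
    seqConv p y n = seqConv p z n := by
  refine Finset.sum_congr rfl fun x hx => ?_
  rw [h x.2 (by rw [Finset.HasAntidiagonal.mem_antidiagonal] at hx; omega)]

theorem seqConv_add (p : PowerSeries ℝ) (y z : ℕ → M) (n : ℕ) :
    seqConv p (fun j => y j + z j) n = seqConv p y n + seqConv p z n := by
  simp [seqConv, Finset.sum_add_distrib]

theorem seqConv_smul (p : PowerSeries ℝ) (r : ℝ) (y : ℕ → M) (n : ℕ) :
    seqConv p (fun j => r • y j) n = r • seqConv p y n := by
  simp [seqConv, Finset.smul_sum, smul_smul, mul_comm]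

theorem map_seqConv (A : M →ₗ[ℝ] M') (p : PowerSeries ℝ) (y : ℕ → M) (n : ℕ) :
    seqConv p (fun j => A (y j)) n = A (seqConv p y n) := by
  simp [seqConv]

end seqConv

/-! ### Inverses of polynomials without roots in the closed unit disc -/

/-- Each factor has the inverse $-\sum_n z^{-n-1}X^n$, a convergent geometric series because
$|z|>1$. Absolute summability is preserved by Cauchy products. -/
theorem exists_summable_inverse_prod (s : Multiset ℂ) (hs : ∀ z ∈ s, 1 < ‖z‖) :
    ∃ q : PowerSeries ℂ, (Summable fun n => ‖PowerSeries.coeff n q‖) ∧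
      q * (((s.map fun z => Polynomial.X - Polynomial.C z).prod : Polynomial ℂ) :
        PowerSeries ℂ) = 1 := by
  induction s using Multiset.induction_on with
  | empty =>
    refine ⟨1, ?_, by simp⟩
    refine summable_of_ne_finset_zero (s := {0}) fun n hn => ?_
    have : n ≠ 0 := by simpa using hn
    simp [PowerSeries.coeff_one, this]
  | cons z s ih =>
    obtain ⟨q, hq, hq1⟩ := ih fun w hw => hs w (Multiset.mem_cons_of_mem hw)
    have hz : 1 < ‖z‖ := hs z (Multiset.mem_cons_self z s)
    have hz0 : z ≠ 0 := by
      rintro rfl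
      simp at hz
      linarith
    set g : PowerSeries ℂ := PowerSeries.mk fun n => -(z⁻¹) ^ (n + 1) with hg
    have hgs : Summable fun n => ‖PowerSeries.coeff n g‖ := by
      have h1 : ‖z⁻¹‖ < 1 := by
        rw [norm_inv]
        exact inv_lt_one_of_one_lt₀ hz
      have h2 : Summable fun n : ℕ => ‖z⁻¹‖ ^ (n + 1) :=
        (summable_nat_add_iff 1).2 (summable_geometric_of_lt_one (norm_nonneg _) h1)
      refine h2.congr fun n => ?_
      simp [hg]
    have hg1 : g * ((Polynomial.X - Polynomial.C z : Polynomial ℂ) : PowerSeries ℂ) = 1 := by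
      ext n
      rw [Polynomial.coe_sub, Polynomial.coe_X, Polynomial.coe_C, mul_sub, map_sub,
        PowerSeries.coeff_mul_C]
      cases n with
      | zero => simp [hg, hz0]
      | succ n =>
        rw [PowerSeries.coeff_succ_mul_X]
        simp only [hg, PowerSeries.coeff_mk, PowerSeries.coeff_one]
        rw [if_neg (Nat.succ_ne_zero n)]
        rw [pow_succ' z⁻¹ (n + 1)]
        linear_combination (z⁻¹) ^ (n + 1) * mul_inv_cancel₀ hz0
    refine ⟨q * g, ?_, ?_⟩
    · have := summable_norm_sum_mul_antidiagonal_of_summable_norm hq hgs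
      refine this.congr fun n => ?_
      rw [PowerSeries.coeff_mul]
    · rw [Multiset.map_cons, Multiset.prod_cons, Polynomial.coe_mul]
      calc q * g * (((Polynomial.X - Polynomial.C z : Polynomial ℂ) : PowerSeries ℂ) *
            (((s.map fun z => Polynomial.X - Polynomial.C z).prod : Polynomial ℂ) :
              PowerSeries ℂ))
          = (g * ((Polynomial.X - Polynomial.C z : Polynomial ℂ) : PowerSeries ℂ)) *
            (q * (((s.map fun z => Polynomial.X - Polynomial.C z).prod : Polynomial ℂ) :
              PowerSeries ℂ)) := by ring
        _ = 1 := by rw [hg1, hq1, one_mul]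

/-- The power series inverse of a real polynomial without complex roots in the closed unit disc
has coefficients tending to zero. -/
theorem exists_inverse_tendsto_zero (p : Polynomial ℝ)
    (hp : ∀ z : ℂ, ‖z‖ ≤ 1 → Polynomial.aeval z p ≠ 0) :
    ∃ r : PowerSeries ℝ, r * (p : PowerSeries ℝ) = 1 ∧
      Filter.Tendsto (fun n => PowerSeries.coeff n r) Filter.atTop (nhds 0) := by
  have h0 : PowerSeries.constantCoeff (p : PowerSeries ℝ) ≠ 0 := by
    have := hp 0 (by simp)
    intro h
    apply this
    rw [← Polynomial.coeff_zero_eq_aeval_zero']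
    simpa using h
  set pc : Polynomial ℂ := p.map (algebraMap ℝ ℂ) with hpc
  have hpc0 : pc ≠ 0 := by
    intro h
    apply hp 0 (by simp)
    rw [← Polynomial.aeval_map_algebraMap ℂ, ← hpc, h]
    simp
  have hroots : ∀ z ∈ pc.roots, 1 < ‖z‖ := by
    intro z hz
    by_contra hle
    apply hp z (not_lt.1 hle)
    have := (Polynomial.mem_roots hpc0).1 hz
    rwa [Polynomial.IsRoot.def, hpc, Polynomial.eval_map_algebraMap] at this
  obtain ⟨q, hq, hq1⟩ := exists_summable_inverse_prod pc.roots hroots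
  have hfac := (IsAlgClosed.splits pc).eq_prod_roots
  have hlc : pc.leadingCoeff ≠ 0 := Polynomial.leadingCoeff_ne_zero.2 hpc0
  set r : PowerSeries ℝ := (p : PowerSeries ℝ)⁻¹ with hr
  have hr1 : r * (p : PowerSeries ℝ) = 1 := PowerSeries.inv_mul_cancel _ h0
  refine ⟨r, hr1, ?_⟩
  have hrc : PowerSeries.map (algebraMap ℝ ℂ) r * (pc : PowerSeries ℂ) = 1 := by
    have := congrArg (PowerSeries.map (algebraMap ℝ ℂ)) hr1
    rwa [map_mul, map_one, ← Polynomial.polynomial_map_coe] at this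
  have hqc : (PowerSeries.C pc.leadingCoeff⁻¹ * q) * (pc : PowerSeries ℂ) = 1 := by
    have hC : (PowerSeries.C pc.leadingCoeff⁻¹ : PowerSeries ℂ) *
        PowerSeries.C pc.leadingCoeff = 1 := by
      rw [← map_mul, inv_mul_cancel₀ hlc, map_one]
    have hfac' := congrArg (fun s : Polynomial ℂ => (s : PowerSeries ℂ)) hfac
    simp only [Polynomial.coe_mul, Polynomial.coe_C] at hfac'
    rw [hfac', mul_mul_mul_comm, hC, hq1, one_mul]
  -- Inverses are unique, so the formal real inverse inherits the decay of the inverse built from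
  -- the complex factorization.
  have heq : PowerSeries.map (algebraMap ℝ ℂ) r = PowerSeries.C pc.leadingCoeff⁻¹ * q :=
    mul_right_cancel₀ (right_ne_zero_of_mul_eq_one hrc) (hrc.trans hqc.symm)
  rw [tendsto_zero_iff_norm_tendsto_zero]
  have h3 : (fun n => ‖PowerSeries.coeff n r‖) =
      fun n => ‖pc.leadingCoeff⁻¹‖ * ‖PowerSeries.coeff n q‖ := by
    funext n
    rw [← norm_mul, ← PowerSeries.coeff_C_mul, ← heq, PowerSeries.coeff_map]
    simp
  rw [h3]
  simpa using hq.tendsto_atTop_zero.const_mul ‖pc.leadingCoeff⁻¹‖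

/-- The convolution of a null sequence of coefficients with a finitely supported sequence is a null
sequence. -/
theorem tendsto_seqConv_zero {V : Type*} [NormedAddCommGroup V] [NormedSpace ℝ V]
    {r : PowerSeries ℝ}
    (hr : Filter.Tendsto (fun n => PowerSeries.coeff n r) Filter.atTop (nhds 0))
    {x : ℕ → V} {m : ℕ} (hx : ∀ n, m < n → x n = 0) :
    Filter.Tendsto (seqConv r x) Filter.atTop (nhds 0) := by
  have h1 : Filter.Tendsto (fun n => ∑ j ∈ Finset.range (m + 1), PowerSeries.coeff (n - j) r • x j)
      Filter.atTop (nhds 0) := by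
    have : Filter.Tendsto
        (fun n => ∑ j ∈ Finset.range (m + 1), PowerSeries.coeff (n - j) r • x j)
        Filter.atTop (nhds (∑ j ∈ Finset.range (m + 1), (0 : ℝ) • x j)) :=
      tendsto_finsetSum _ fun j _ =>
        (hr.comp (Filter.tendsto_sub_atTop_nat j)).smul_const (x j)
    simpa using this
  refine h1.congr' ?_
  filter_upwards [Filter.eventually_ge_atTop m] with n hn
  rw [seqConv, ← Finset.Nat.sum_antidiagonal_swap]
  simp only [Prod.fst_swap, Prod.snd_swap]
  rw [Finset.Nat.sum_antidiagonal_eq_sum_range_succ_mk]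
  refine Finset.sum_subset (Finset.range_subset_range.2 (by omega)) fun j hj hj' => ?_
  rw [hx j (by simpa using hj'), smul_zero]

/-! ### Discrete Parseval identity and symbols of Toeplitz forms -/

/-- The powers of $e^{2\pi ij/P}$ sum to zero: it is a $P$-th root of unity, different from $1$
because $0<|j|<P$. -/
theorem sum_cos_int_mul_eq_zero {P : ℕ} {j : ℤ} (hj : j ≠ 0) (hjP : |j| < P) :
    ∑ l ∈ Finset.range P, Real.cos (j * (2 * Real.pi * l / P)) = 0 := by
  have hP : 0 < (P : ℤ) := lt_of_le_of_lt (abs_nonneg j) hjP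
  have hPC : (P : ℂ) ≠ 0 := by
    have : (P : ℤ) ≠ 0 := hP.ne'
    exact_mod_cast this
  set ζ : ℂ := Complex.exp (2 * Real.pi * Complex.I * (j / P)) with hζ
  have h1 : ζ ^ P = 1 := by
    rw [hζ, ← Complex.exp_nat_mul, Complex.exp_eq_one_iff]
    exact ⟨j, by field_simp⟩
  have h2 : ζ ≠ 1 := by
    intro h
    rw [hζ, Complex.exp_eq_one_iff] at h
    obtain ⟨n, hn⟩ := h
    have hpi : (2 * Real.pi * Complex.I : ℂ) ≠ 0 := Complex.two_pi_I_ne_zero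
    rw [mul_comm (n : ℂ)] at hn
    have h3 := mul_left_cancel₀ hpi hn
    rw [div_eq_iff hPC] at h3
    have h4 : j = n * P := by exact_mod_cast h3
    have : (P : ℤ) ∣ j := ⟨n, by rw [h4, mul_comm]⟩
    exact hj (Int.eq_zero_of_abs_lt_dvd this hjP)
  have h3 : ∑ l ∈ Finset.range P, ζ ^ l = 0 := by
    have := mul_geom_sum ζ P
    rw [h1, sub_self] at this
    exact (mul_eq_zero.1 this).resolve_left (sub_ne_zero.2 h2)
  have h4 := congrArg Complex.re h3
  rw [Complex.re_sum, Complex.zero_re] at h4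
  rw [← h4]
  refine Finset.sum_congr rfl fun l _ => ?_
  rw [hζ, ← Complex.exp_nat_mul, ← Complex.exp_ofReal_mul_I_re]
  congr 2
  push_cast
  ring

theorem sum_cos_mul_cos_add_sin_mul_sin {P n m : ℕ} (hn : n < P) (hm : m < P) :
    ∑ l ∈ Finset.range P, (Real.cos (n * (2 * Real.pi * l / P)) *
        Real.cos (m * (2 * Real.pi * l / P)) +
        Real.sin (n * (2 * Real.pi * l / P)) * Real.sin (m * (2 * Real.pi * l / P))) =
      if n = m then (P : ℝ) else 0 := by
  simp only [← Real.cos_sub, ← sub_mul]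
  split_ifs with h
  · simp [h]
  · have := sum_cos_int_mul_eq_zero (P := P) (j := (n : ℤ) - m) (by omega)
      (by rw [abs_lt]; omega)
    push_cast at this
    exact this

/-- The triangle $i+s<A$ may be completed to a square because $f$ vanishes on the rest. -/
theorem sum_range_sum_antidiagonal {M : Type*} [AddCommMonoid M] (f : ℕ × ℕ → M) (A : ℕ)
    (hf : ∀ i s, A ≤ i + s → f (i, s) = 0) :
    ∑ n ∈ Finset.range A, ∑ x ∈ Finset.HasAntidiagonal.antidiagonal n, f x =
      ∑ i ∈ Finset.range A, ∑ s ∈ Finset.range A, f (i, s) := by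
  rw [Finset.sum_sigma', ← Finset.sum_product' (f := fun i s => f (i, s)),
    ← Finset.sum_filter_of_ne (p := fun x : ℕ × ℕ => x.1 + x.2 < A)]
  · refine Finset.sum_nbij' (fun x => x.2) (fun x => ⟨x.1 + x.2, x⟩) ?_ ?_ ?_ ?_ ?_
    · rintro ⟨n, a, b⟩ h
      simp only [Finset.mem_sigma, Finset.mem_range, Finset.HasAntidiagonal.mem_antidiagonal,
        Finset.mem_filter, Finset.mem_product] at h ⊢
      omega
    · rintro ⟨a, b⟩ h
      simp only [Finset.mem_sigma, Finset.mem_range, Finset.HasAntidiagonal.mem_antidiagonal,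
        Finset.mem_filter, Finset.mem_product, and_true] at h ⊢
      omega
    · rintro ⟨n, a, b⟩ h
      simp only [Finset.mem_sigma, Finset.HasAntidiagonal.mem_antidiagonal] at h
      obtain ⟨_, rfl⟩ := h
      rfl
    · rintro ⟨a, b⟩ _
      rfl
    · rintro ⟨n, a, b⟩ _
      rfl
  · rintro ⟨a, b⟩ _ hne
    by_contra h
    exact hne (hf a b (not_lt.1 h))

section Fourier

variable {V : Type*} [NormedAddCommGroup V] [InnerProductSpace ℝ V]

/-- The cosine transform of the first `A` terms of a sequence. -/
noncomputable def cosSum (θ : ℝ) (y : ℕ → V) (A : ℕ) : V :=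
  ∑ n ∈ Finset.range A, Real.cos (n * θ) • y n

/-- The sine transform of the first `A` terms of a sequence. -/
noncomputable def sinSum (θ : ℝ) (y : ℕ → V) (A : ℕ) : V :=
  ∑ n ∈ Finset.range A, Real.sin (n * θ) • y n

/-- `cosSum` and `sinSum` are the two components of the discrete Fourier transform. Keeping both of
them avoids complexifying $V$. -/
theorem discrete_parseval (B : V →L[ℝ] StrongDual ℝ V) (x z : ℕ → V) (A : ℕ) :
    ∑ l ∈ Finset.range A,
        (B (cosSum (2 * Real.pi * l / A) x A) (cosSum (2 * Real.pi * l / A) z A) +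
          B (sinSum (2 * Real.pi * l / A) x A) (sinSum (2 * Real.pi * l / A) z A)) =
      A * ∑ n ∈ Finset.range A, B (x n) (z n) := by
  have h1 : ∀ l : ℕ, B (cosSum (2 * Real.pi * l / A) x A) (cosSum (2 * Real.pi * l / A) z A) +
          B (sinSum (2 * Real.pi * l / A) x A) (sinSum (2 * Real.pi * l / A) z A) =
      ∑ n ∈ Finset.range A, ∑ m ∈ Finset.range A,
        (Real.cos (n * (2 * Real.pi * l / A)) * Real.cos (m * (2 * Real.pi * l / A)) +
        Real.sin (n * (2 * Real.pi * l / A)) * Real.sin (m * (2 * Real.pi * l / A))) *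
          B (x n) (z m) := by
    intro l
    simp only [cosSum, sinSum, map_sum, map_smul, sum_apply,
      smul_apply, smul_eq_mul]
    rw [Finset.sum_comm, ← Finset.sum_add_distrib]
    refine Finset.sum_congr rfl fun n _ => ?_
    rw [Finset.mul_sum, Finset.mul_sum, ← Finset.sum_add_distrib]
    refine Finset.sum_congr rfl fun m _ => ?_
    ring
  rw [Finset.sum_congr rfl fun l _ => h1 l, Finset.sum_comm, Finset.mul_sum]
  refine Finset.sum_congr rfl fun n hn => ?_
  rw [Finset.sum_comm, Finset.sum_eq_single n]
  · rw [← Finset.sum_mul, sum_cos_mul_cos_add_sin_mul_sin (Finset.mem_range.1 hn)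
      (Finset.mem_range.1 hn), if_pos rfl]
  · intro m hm hne
    rw [← Finset.sum_mul, sum_cos_mul_cos_add_sin_mul_sin (Finset.mem_range.1 hn)
      (Finset.mem_range.1 hm), if_neg hne.symm, zero_mul]
  · intro h
    exact absurd hn h

/-- The value `p(e^{iθ})` of a real polynomial on the unit circle. -/
noncomputable def circleEval (p : Polynomial ℝ) (θ : ℝ) : ℂ :=
  Polynomial.aeval (Complex.exp (θ * Complex.I)) p

theorem circleEval_eq_sum {p : Polynomial ℝ} {A : ℕ} (hp : p.natDegree < A) (θ : ℝ) :
    circleEval p θ = ∑ i ∈ Finset.range A,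
      (p.coeff i : ℂ) * Complex.exp (((i * θ : ℝ) : ℂ) * Complex.I) := by
  rw [circleEval, Polynomial.aeval_eq_sum_range' hp]
  refine Finset.sum_congr rfl fun i _ => ?_
  rw [← Complex.exp_nat_mul, Complex.real_smul]
  congr 2
  push_cast
  ring

theorem circleEval_re {p : Polynomial ℝ} {A : ℕ} (hp : p.natDegree < A) (θ : ℝ) :
    (circleEval p θ).re = ∑ i ∈ Finset.range A, p.coeff i * Real.cos (i * θ) := by
  rw [circleEval_eq_sum hp, Complex.re_sum]
  refine Finset.sum_congr rfl fun i _ => ?_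
  rw [Complex.re_ofReal_mul, Complex.exp_ofReal_mul_I_re]

theorem circleEval_im {p : Polynomial ℝ} {A : ℕ} (hp : p.natDegree < A) (θ : ℝ) :
    (circleEval p θ).im = ∑ i ∈ Finset.range A, p.coeff i * Real.sin (i * θ) := by
  rw [circleEval_eq_sum hp, Complex.im_sum]
  refine Finset.sum_congr rfl fun i _ => ?_
  rw [Complex.im_ofReal_mul, Complex.exp_ofReal_mul_I_im]

theorem sum_smul_seqConv {p : Polynomial ℝ} {y : ℕ → V} {K M A : ℕ} (hp : p.natDegree ≤ K)
    (hy : ∀ s, M ≤ s → y s = 0) (hA : M + K ≤ A) (w : ℕ → ℝ) :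
    ∑ n ∈ Finset.range A, w n • seqConv (p : PowerSeries ℝ) y n =
      ∑ i ∈ Finset.range A, ∑ s ∈ Finset.range A, (w (i + s) * p.coeff i) • y s := by
  rw [← sum_range_sum_antidiagonal (fun x => (w (x.1 + x.2) * p.coeff x.1) • y x.2)]
  · refine Finset.sum_congr rfl fun n _ => ?_
    rw [seqConv, Finset.smul_sum]
    refine Finset.sum_congr rfl fun x hx => ?_
    rw [Finset.HasAntidiagonal.mem_antidiagonal] at hx
    rw [smul_smul, hx, Polynomial.coeff_coe]
  · intro i s h
    by_cases hs : M ≤ s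
    · simp [hy s hs]
    · have : p.coeff i = 0 := Polynomial.coeff_eq_zero_of_natDegree_lt (by omega)
      simp [this]

/-- One component of the rule that the transform of a convolution is a product, by the addition
formula for the cosine. The window `A` is long enough to contain the whole support of the
convolution. -/
theorem cosSum_seqConv {p : Polynomial ℝ} {y : ℕ → V} {K M A : ℕ} (hp : p.natDegree ≤ K)
    (hy : ∀ s, M ≤ s → y s = 0) (hA : M + K < A) (θ : ℝ) :
    cosSum θ (seqConv (p : PowerSeries ℝ) y) A =
      (circleEval p θ).re • cosSum θ y A - (circleEval p θ).im • sinSum θ y A := by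
  rw [cosSum, sum_smul_seqConv hp hy hA.le, circleEval_re (A := A) (by omega),
    circleEval_im (A := A) (by omega), cosSum, sinSum, Finset.sum_smul_sum, Finset.sum_smul_sum,
    ← Finset.sum_sub_distrib]
  refine Finset.sum_congr rfl fun i _ => ?_
  rw [← Finset.sum_sub_distrib]
  refine Finset.sum_congr rfl fun s _ => ?_
  rw [smul_smul, smul_smul, ← sub_smul, Nat.cast_add, add_mul, Real.cos_add]
  congr 1
  ring

theorem sinSum_seqConv {p : Polynomial ℝ} {y : ℕ → V} {K M A : ℕ} (hp : p.natDegree ≤ K)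
    (hy : ∀ s, M ≤ s → y s = 0) (hA : M + K < A) (θ : ℝ) :
    sinSum θ (seqConv (p : PowerSeries ℝ) y) A =
      (circleEval p θ).im • cosSum θ y A + (circleEval p θ).re • sinSum θ y A := by
  rw [sinSum, sum_smul_seqConv hp hy hA.le, circleEval_re (A := A) (by omega),
    circleEval_im (A := A) (by omega), cosSum, sinSum, Finset.sum_smul_sum, Finset.sum_smul_sum,
    ← Finset.sum_add_distrib]
  refine Finset.sum_congr rfl fun i _ => ?_
  rw [← Finset.sum_add_distrib]
  refine Finset.sum_congr rfl fun s _ => ?_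
  rw [smul_smul, smul_smul, ← add_smul, Nat.cast_add, add_mul, Real.sin_add]
  congr 1
  ring

theorem sum_form_seqConv {B : V →L[ℝ] StrongDual ℝ V} (hB : ∀ v w, B v w = B w v)
    {p q : Polynomial ℝ} {y : ℕ → V} {K M A : ℕ} (hp : p.natDegree ≤ K) (hq : q.natDegree ≤ K)
    (hy : ∀ s, M ≤ s → y s = 0) (hA : M + K < A) :
    A * ∑ n ∈ Finset.range A,
        B (seqConv (p : PowerSeries ℝ) y n) (seqConv (q : PowerSeries ℝ) y n) =
      ∑ l ∈ Finset.range A,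
        (circleEval p (2 * Real.pi * l / A) * star (circleEval q (2 * Real.pi * l / A))).re *
          (B (cosSum (2 * Real.pi * l / A) y A) (cosSum (2 * Real.pi * l / A) y A) +
            B (sinSum (2 * Real.pi * l / A) y A) (sinSum (2 * Real.pi * l / A) y A)) := by
  rw [← discrete_parseval]
  refine Finset.sum_congr rfl fun l _ => ?_
  rw [cosSum_seqConv hp hy hA, cosSum_seqConv hq hy hA, sinSum_seqConv hp hy hA,
    sinSum_seqConv hq hy hA]
  simp only [map_sub, map_add, map_smul, sub_apply,
    add_apply, smul_apply, smul_eq_mul, Complex.mul_re,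
    Complex.star_def, Complex.conj_re, Complex.conj_im]
  -- By symmetry of the form the mixed sine-cosine terms cancel, so only the real part of the symbol
  -- $p\bar q$ survives.
  rw [hB (sinSum _ y A) (cosSum _ y A)]
  ring

/-- A pointwise inequality between symbols gives an inequality between the Toeplitz forms, on
finitely supported sequences. -/
theorem form_seqConv_le {B : V →L[ℝ] StrongDual ℝ V} (hB : ∀ v w, B v w = B w v)
    (hB0 : ∀ v, 0 ≤ B v v) {p₁ q₁ p₂ q₂ : Polynomial ℝ} {c₁ c₂ : ℝ} {y : ℕ → V} {K M A : ℕ}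
    (hp₁ : p₁.natDegree ≤ K) (hq₁ : q₁.natDegree ≤ K) (hp₂ : p₂.natDegree ≤ K)
    (hq₂ : q₂.natDegree ≤ K) (hy : ∀ s, M ≤ s → y s = 0) (hA : M + K < A)
    (h : ∀ θ ∈ Set.Ico 0 (2 * Real.pi), c₁ * (circleEval p₁ θ * star (circleEval q₁ θ)).re ≤
      c₂ * (circleEval p₂ θ * star (circleEval q₂ θ)).re) :
    c₁ * ∑ n ∈ Finset.range A,
        B (seqConv (p₁ : PowerSeries ℝ) y n) (seqConv (q₁ : PowerSeries ℝ) y n) ≤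
      c₂ * ∑ n ∈ Finset.range A,
        B (seqConv (p₂ : PowerSeries ℝ) y n) (seqConv (q₂ : PowerSeries ℝ) y n) := by
  have hA0 : (0 : ℝ) < A := by
    have : 0 < A := by omega
    exact_mod_cast this
  refine le_of_mul_le_mul_left ?_ hA0
  rw [mul_left_comm, sum_form_seqConv hB hp₁ hq₁ hy hA, mul_left_comm,
    sum_form_seqConv hB hp₂ hq₂ hy hA, Finset.mul_sum, Finset.mul_sum]
  refine Finset.sum_le_sum fun l hl => ?_
  rw [← mul_assoc, ← mul_assoc]
  refine mul_le_mul_of_nonneg_right (h _ ⟨by positivity, ?_⟩) (add_nonneg (hB0 _) (hB0 _))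
  rw [div_lt_iff₀ hA0]
  have : (l : ℝ) < A := by exact_mod_cast Finset.mem_range.1 hl
  exact mul_lt_mul_of_pos_left this (by positivity)

end Fourier

/-! ### Toeplitz forms with rational symbols -/

theorem seqConv_polynomial {M : Type*} [AddCommGroup M] [Module ℝ M] {p : Polynomial ℝ} {K : ℕ}
    (hp : p.natDegree ≤ K) (y : ℕ → M) (n : ℕ) :
    seqConv (p : PowerSeries ℝ) y n =
      ∑ i ∈ (Finset.range (K + 1)).filter (fun i => i ≤ n), p.coeff i • y (n - i) := by
  rw [seqConv, Finset.Nat.sum_antidiagonal_eq_sum_range_succ_mk]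
  symm
  refine Finset.sum_subset_zero_on_sdiff ?_ ?_ ?_
  · intro i hi
    simp only [Finset.mem_filter, Finset.mem_range] at hi ⊢
    omega
  · intro i hi
    simp only [Finset.mem_sdiff, Finset.mem_filter, Finset.mem_range, not_and, not_le] at hi
    have : p.coeff i = 0 := Polynomial.coeff_eq_zero_of_natDegree_lt (by omega)
    simp [this]
  · intro i _
    simp

section Toeplitz

variable {V : Type*} [NormedAddCommGroup V] [InnerProductSpace ℝ V]

/-- At a fixed distance beyond the cut only $K+1$ values of `y` enter, and their indices move to
infinity with `M`. -/
theorem tendsto_seqConv_truncation_tail {y : ℕ → V} (hy : Filter.Tendsto y Filter.atTop (nhds 0))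
    {p : Polynomial ℝ} {K : ℕ} (hp : p.natDegree ≤ K) (h : ℕ) :
    Filter.Tendsto (fun M => seqConv (p : PowerSeries ℝ) (fun s => if s ≤ M then y s else 0)
      (M + 1 + h)) Filter.atTop (nhds 0) := by
  have h1 : Filter.Tendsto (fun M => ∑ i ∈ Finset.range (K + 1),
      p.coeff i • (if M + 1 + h - i ≤ M then y (M + 1 + h - i) else 0)) Filter.atTop (nhds 0) := by
    have : Filter.Tendsto (fun M => ∑ i ∈ Finset.range (K + 1),
      p.coeff i • (if M + 1 + h - i ≤ M then y (M + 1 + h - i) else 0)) Filter.atTop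
        (nhds (∑ i ∈ Finset.range (K + 1), p.coeff i • (0 : V))) := by
      refine tendsto_finsetSum _ fun i _ => Filter.Tendsto.const_smul ?_ _
      have h2 : Filter.Tendsto (fun M => y (M + 1 + h - i)) Filter.atTop (nhds 0) := by
        refine hy.comp ((Filter.tendsto_sub_atTop_nat i).comp ?_)
        simpa [add_assoc] using Filter.tendsto_add_atTop_nat (1 + h)
      refine squeeze_zero_norm (fun M => ?_) (tendsto_zero_iff_norm_tendsto_zero.1 h2)
      split_ifs
      · exact le_rfl
      · simp
    simpa using this
  refine h1.congr' ?_
  filter_upwards [Filter.eventually_ge_atTop K] with M hM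
  rw [seqConv_polynomial hp, Finset.filter_true_of_mem]
  intro i hi
  rw [Finset.mem_range] at hi
  omega

theorem tendsto_form_zero (B : V →L[ℝ] StrongDual ℝ V) {a b : ℕ → V}
    (ha : Filter.Tendsto a Filter.atTop (nhds 0)) (hb : Filter.Tendsto b Filter.atTop (nhds 0)) :
    Filter.Tendsto (fun n => B (a n) (b n)) Filter.atTop (nhds (0 : ℝ)) := by
  have h1 : Filter.Tendsto (fun p : V × V => B p.1 p.2) (nhds (0, 0)) (nhds (B 0 0)) :=
    B.continuous₂.tendsto (0, 0)
  rw [map_zero] at h1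
  exact h1.comp (ha.prodMk_nhds hb)

/-- The boundary terms created by truncating a null sequence disappear in the limit. -/
theorem tendsto_form_truncation_sub (B : V →L[ℝ] StrongDual ℝ V) {y : ℕ → V}
    (hy : Filter.Tendsto y Filter.atTop (nhds 0)) {p q : Polynomial ℝ} {K : ℕ}
    (hp : p.natDegree ≤ K) (hq : q.natDegree ≤ K) :
    Filter.Tendsto (fun M =>
      ∑ n ∈ Finset.range (M + 1 + (K + 1)),
        B (seqConv (p : PowerSeries ℝ) (fun s => if s ≤ M then y s else 0) n)
          (seqConv (q : PowerSeries ℝ) (fun s => if s ≤ M then y s else 0) n) -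
      ∑ n ∈ Finset.range (M + 1),
        B (seqConv (p : PowerSeries ℝ) y n) (seqConv (q : PowerSeries ℝ) y n))
      Filter.atTop (nhds 0) := by
  have h1 : Filter.Tendsto (fun M => ∑ h ∈ Finset.range (K + 1),
        B (seqConv (p : PowerSeries ℝ) (fun s => if s ≤ M then y s else 0) (M + 1 + h))
          (seqConv (q : PowerSeries ℝ) (fun s => if s ≤ M then y s else 0) (M + 1 + h)))
      Filter.atTop (nhds (∑ h ∈ Finset.range (K + 1), 0)) :=
    tendsto_finsetSum _ fun h _ =>
      tendsto_form_zero B (tendsto_seqConv_truncation_tail hy hp h)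
        (tendsto_seqConv_truncation_tail hy hq h)
  simp only [Finset.sum_const_zero] at h1
  refine h1.congr fun M => ?_
  rw [Finset.sum_range_add _ (M + 1) (K + 1), eq_sub_iff_add_eq, add_comm]
  congr 1
  refine Finset.sum_congr rfl fun n hn => ?_
  have hn' : n < M + 1 := Finset.mem_range.1 hn
  have hc : ∀ j ≤ n, y j = if j ≤ M then y j else 0 := fun j hj => by
    rw [if_pos (by omega)]
  rw [seqConv_congr hc, seqConv_congr (p := (q : PowerSeries ℝ)) hc]

theorem sum_range_eq_of_forall_lt {f : ℕ → ℝ} {m : ℕ} (hf : ∀ n, m < n → f n = 0) {M : ℕ}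
    (hM : m ≤ M) : ∑ n ∈ Finset.range (M + 1), f n = ∑ n ∈ Finset.range (m + 1), f n := by
  symm
  refine Finset.sum_subset (Finset.range_subset_range.2 (by omega)) fun n _ hn => hf n ?_
  simpa using hn

variable {B : V →L[ℝ] StrongDual ℝ V} {α : Polynomial ℝ} {r : PowerSeries ℝ}

theorem seqConv_mul_truncation_apply {p : Polynomial ℝ} {x : ℕ → V} {m n : ℕ} (hn : n ≤ m) :
    seqConv (p : PowerSeries ℝ) (seqConv r fun j => if j ≤ m then x j else 0) n =
      seqConv (r * (p : PowerSeries ℝ)) x n := by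
  rw [mul_comm, seqConv_mul]
  refine seqConv_congr fun j hj => seqConv_congr fun i hi => ?_
  rw [if_pos (by omega)]

theorem seqConv_inverse_truncation (hr : r * (α : PowerSeries ℝ) = 1) (x : ℕ → V) (m n : ℕ) :
    seqConv (α : PowerSeries ℝ) (seqConv r fun j => if j ≤ m then x j else 0) n =
      if n ≤ m then x n else 0 := by
  rw [← seqConv_mul, mul_comm, hr, seqConv_one]

/-- If `λ |α|² ≤ Re (β conj α)` on the unit circle, then the lower triangular Toeplitz operator with
symbol `β / α` is coercive with constant `λ`. -/
theorem coercive_seqConv_div (hB : ∀ v w, B v w = B w v) (hB0 : ∀ v, 0 ≤ B v v)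
    (hr : r * (α : PowerSeries ℝ) = 1)
    (hr0 : Filter.Tendsto (fun n => PowerSeries.coeff n r) Filter.atTop (nhds 0))
    {β : Polynomial ℝ} {c : ℝ}
    (h : ∀ θ ∈ Set.Ico 0 (2 * Real.pi), c * (circleEval α θ * star (circleEval α θ)).re ≤
      (circleEval β θ * star (circleEval α θ)).re) (x : ℕ → V) (m : ℕ) :
    c * ∑ n ∈ Finset.range (m + 1), B (x n) (x n) ≤
      ∑ n ∈ Finset.range (m + 1), B (seqConv (r * (β : PowerSeries ℝ)) x n) (x n) := by
  -- With $y=\alpha^{-1}*x$ for $x$ cut off after $m$, the convolution $\alpha*y$ returns the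
  -- cut-off $x$, and $\beta*y$ agrees with $(\beta/\alpha)*x$ up to index $m$. The rational symbol
  -- is thereby reduced to polynomial ones.
  set y : ℕ → V := seqConv r fun j => if j ≤ m then x j else 0 with hy
  have hy0 : Filter.Tendsto y Filter.atTop (nhds 0) :=
    tendsto_seqConv_zero hr0 (m := m) fun n hn => if_neg (not_le.2 hn)
  set K := max α.natDegree β.natDegree with hK
  have hα : α.natDegree ≤ K := le_max_left _ _
  have hβ : β.natDegree ≤ K := le_max_right _ _
  have h1 := tendsto_form_truncation_sub B hy0 hα hα
  have h2 := tendsto_form_truncation_sub B hy0 hβ hα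
  have hαy : ∀ n, seqConv (α : PowerSeries ℝ) y n = if n ≤ m then x n else 0 :=
    seqConv_inverse_truncation hr x m
  have h1' : ∀ M, m ≤ M → ∑ n ∈ Finset.range (M + 1),
      B (seqConv (α : PowerSeries ℝ) y n) (seqConv (α : PowerSeries ℝ) y n) =
      ∑ n ∈ Finset.range (m + 1), B (x n) (x n) := by
    intro M hM
    rw [sum_range_eq_of_forall_lt (m := m) _ hM]
    · refine Finset.sum_congr rfl fun n hn => ?_
      rw [hαy, if_pos (Nat.lt_succ_iff.1 (Finset.mem_range.1 hn))]
    · intro n hn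
      rw [hαy, if_neg (not_le.2 hn), map_zero]
  have h2' : ∀ M, m ≤ M → ∑ n ∈ Finset.range (M + 1),
      B (seqConv (β : PowerSeries ℝ) y n) (seqConv (α : PowerSeries ℝ) y n) =
      ∑ n ∈ Finset.range (m + 1), B (seqConv (r * (β : PowerSeries ℝ)) x n) (x n) := by
    intro M hM
    rw [sum_range_eq_of_forall_lt (m := m) _ hM]
    · refine Finset.sum_congr rfl fun n hn => ?_
      have hn' : n ≤ m := Nat.lt_succ_iff.1 (Finset.mem_range.1 hn)
      rw [hαy, if_pos hn', hy, seqConv_mul_truncation_apply hn']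
    · intro n hn
      rw [hαy, if_neg (not_le.2 hn), map_zero]
  have h3 := h2.sub (h1.const_mul c)
  rw [mul_zero, sub_zero] at h3
  have h4 := h3.add_const (∑ n ∈ Finset.range (m + 1),
    B (seqConv (r * (β : PowerSeries ℝ)) x n) (x n) -
      c * ∑ n ∈ Finset.range (m + 1), B (x n) (x n))
  rw [zero_add] at h4
  rw [← sub_nonneg]
  -- The sequence `y` tends to zero but need not have finite support. The polynomial inequality is
  -- applied to its truncation at `M`, whose boundary terms disappear as `M` grows.
  refine ge_of_tendsto h4 ?_
  filter_upwards [Filter.eventually_ge_atTop m] with M hM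
  have h5 := form_seqConv_le hB hB0 (p₁ := α) (q₁ := α) (p₂ := β) (q₂ := α) (c₁ := c) (c₂ := 1)
    (y := fun s => if s ≤ M then y s else 0) (K := K) (M := M + 1) (A := M + 1 + (K + 1))
    hα hα hβ hα (fun s hs => if_neg (by omega)) (by omega)
    (fun θ hθ => by rw [one_mul]; exact h θ hθ)
  have h6 := h1' M hM
  have h7 := h2' M hM
  rw [h6, h7]
  linarith

/-- If `|γ|² ≤ σ² |α|²` on the unit circle, then the lower triangular Toeplitz operator with
symbol `γ / α` is bounded by `σ`. -/
theorem bounded_seqConv_div (hB : ∀ v w, B v w = B w v) (hB0 : ∀ v, 0 ≤ B v v)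
    (hr : r * (α : PowerSeries ℝ) = 1)
    (hr0 : Filter.Tendsto (fun n => PowerSeries.coeff n r) Filter.atTop (nhds 0))
    {γ : Polynomial ℝ} {σ : ℝ}
    (h : ∀ θ ∈ Set.Ico 0 (2 * Real.pi), (circleEval γ θ * star (circleEval γ θ)).re ≤
      σ ^ 2 * (circleEval α θ * star (circleEval α θ)).re) (x : ℕ → V) (m : ℕ) :
    ∑ n ∈ Finset.range (m + 1), B (seqConv (r * (γ : PowerSeries ℝ)) x n)
        (seqConv (r * (γ : PowerSeries ℝ)) x n) ≤
      σ ^ 2 * ∑ n ∈ Finset.range (m + 1), B (x n) (x n) := by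
  set y : ℕ → V := seqConv r fun j => if j ≤ m then x j else 0 with hy
  have hy0 : Filter.Tendsto y Filter.atTop (nhds 0) :=
    tendsto_seqConv_zero hr0 (m := m) fun n hn => if_neg (not_le.2 hn)
  set K := max α.natDegree γ.natDegree with hK
  have hα : α.natDegree ≤ K := le_max_left _ _
  have hγ : γ.natDegree ≤ K := le_max_right _ _
  have h1 := tendsto_form_truncation_sub B hy0 hα hα
  have h2 := tendsto_form_truncation_sub B hy0 hγ hγ
  have hαy : ∀ n, seqConv (α : PowerSeries ℝ) y n = if n ≤ m then x n else 0 :=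
    seqConv_inverse_truncation hr x m
  have h1' : ∀ M, m ≤ M → ∑ n ∈ Finset.range (M + 1),
      B (seqConv (α : PowerSeries ℝ) y n) (seqConv (α : PowerSeries ℝ) y n) =
      ∑ n ∈ Finset.range (m + 1), B (x n) (x n) := by
    intro M hM
    rw [sum_range_eq_of_forall_lt (m := m) _ hM]
    · refine Finset.sum_congr rfl fun n hn => ?_
      rw [hαy, if_pos (Nat.lt_succ_iff.1 (Finset.mem_range.1 hn))]
    · intro n hn
      rw [hαy, if_neg (not_le.2 hn), map_zero]
  -- Unlike $\alpha*y$, the sequence $\gamma*y$ need not vanish beyond $m$. Those terms are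
  -- nonnegative, so only an inequality remains.
  have h2' : ∀ M, m ≤ M →
      ∑ n ∈ Finset.range (m + 1), B (seqConv (r * (γ : PowerSeries ℝ)) x n)
        (seqConv (r * (γ : PowerSeries ℝ)) x n) ≤ ∑ n ∈ Finset.range (M + 1),
      B (seqConv (γ : PowerSeries ℝ) y n) (seqConv (γ : PowerSeries ℝ) y n) := by
    intro M hM
    refine le_trans (le_of_eq ?_) (Finset.sum_le_sum_of_subset_of_nonneg
      (Finset.range_subset_range.2 (Nat.succ_le_succ hM)) fun n _ _ => hB0 _)
    refine Finset.sum_congr rfl fun n hn => ?_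
    have hn' : n ≤ m := Nat.lt_succ_iff.1 (Finset.mem_range.1 hn)
    rw [hy, seqConv_mul_truncation_apply hn']
  have h3 := (h1.const_mul (σ ^ 2)).sub h2
  rw [mul_zero, sub_zero] at h3
  have h4 := h3.add_const (σ ^ 2 * ∑ n ∈ Finset.range (m + 1), B (x n) (x n) -
    ∑ n ∈ Finset.range (m + 1), B (seqConv (r * (γ : PowerSeries ℝ)) x n)
        (seqConv (r * (γ : PowerSeries ℝ)) x n))
  rw [zero_add] at h4
  rw [← sub_nonneg]
  refine ge_of_tendsto h4 ?_
  filter_upwards [Filter.eventually_ge_atTop m] with M hM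
  have h5 := form_seqConv_le hB hB0 (p₁ := γ) (q₁ := γ) (p₂ := α) (q₂ := α) (c₁ := 1)
    (c₂ := σ ^ 2) (y := fun s => if s ≤ M then y s else 0) (K := K) (M := M + 1)
    (A := M + 1 + (K + 1)) hγ hγ hα hα (fun s hs => if_neg (by omega)) (by omega)
    (fun θ hθ => by rw [one_mul]; exact h θ hθ)
  have h6 := h1' M hM
  have h7 := h2' M hM
  rw [h6]
  linarith

end Toeplitz

/-! ### Generating polynomials of a multistep method -/

/-- The polynomial `∑_{j<k} a_j X^j`. -/
noncomputable def genPoly (a : ℕ → ℝ) (k : ℕ) : Polynomial ℝ :=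
  ∑ j ∈ Finset.range k, Polynomial.monomial j (a j)

theorem genPoly_coeff (a : ℕ → ℝ) (k i : ℕ) :
    (genPoly a k).coeff i = if i < k then a i else 0 := by
  simp [genPoly, Polynomial.coeff_monomial]

theorem genPoly_natDegree_le (a : ℕ → ℝ) (k : ℕ) : (genPoly a k).natDegree ≤ k := by
  rw [Polynomial.natDegree_le_iff_coeff_eq_zero]
  intro i hi
  rw [genPoly_coeff, if_neg (by omega)]

theorem aeval_genPoly (a : ℕ → ℝ) (k : ℕ) (z : ℂ) :
    Polynomial.aeval z (genPoly a k) = ∑ j ∈ Finset.range k, (a j : ℂ) * z ^ j := by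
  simp [genPoly, Polynomial.aeval_monomial]

theorem circleEval_genPoly (a : ℕ → ℝ) (k : ℕ) (θ : ℝ) :
    circleEval (genPoly a k) θ =
      ∑ j ∈ Finset.range k, (a j : ℂ) * Complex.exp (Complex.I * j * θ) := by
  rw [circleEval, aeval_genPoly]
  refine Finset.sum_congr rfl fun j _ => ?_
  rw [← Complex.exp_nat_mul]
  congr 2
  ring

theorem seqConv_genPoly {M : Type*} [AddCommGroup M] [Module ℝ M] (a : ℕ → ℝ) (k : ℕ) (y : ℕ → M)
    (n : ℕ) : seqConv (genPoly a k : PowerSeries ℝ) y n =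
      ∑ j ∈ (Finset.range k).filter (fun j => j ≤ n), a j • y (n - j) := by
  rw [seqConv_polynomial (genPoly_natDegree_le a k)]
  symm
  refine Finset.sum_subset_zero_on_sdiff ?_ ?_ ?_
  · intro i hi
    simp only [Finset.mem_filter, Finset.mem_range] at hi ⊢
    omega
  · intro i hi
    simp only [Finset.mem_sdiff, Finset.mem_filter, Finset.mem_range, not_and, not_le] at hi
    rw [genPoly_coeff, if_neg (by omega), zero_smul]
  · intro i hi
    simp only [Finset.mem_filter, Finset.mem_range] at hi
    rw [genPoly_coeff, if_pos hi.1]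

/-- The summand $j=n$ carries `y 0 = 0`. Dropping it gives the index range `j < n` used in
`IEMS.residual` for differences and explicit terms. -/
theorem seqConv_genPoly_of_zero {M : Type*} [AddCommGroup M] [Module ℝ M] (a : ℕ → ℝ) (k : ℕ)
    {y : ℕ → M} (hy : y 0 = 0) (n : ℕ) : seqConv (genPoly a k : PowerSeries ℝ) y n =
      ∑ j ∈ (Finset.range k).filter (fun j => j < n), a j • y (n - j) := by
  rw [seqConv_genPoly]
  symm
  refine Finset.sum_subset_zero_on_sdiff ?_ ?_ fun _ _ => rfl
  · intro i hi
    simp only [Finset.mem_filter, Finset.mem_range] at hi ⊢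
    omega
  · intro i hi
    simp only [Finset.mem_sdiff, Finset.mem_filter, Finset.mem_range, not_and, not_lt] at hi
    rw [Nat.sub_eq_zero_of_le (by omega), hy, smul_zero]

namespace IEMS

variable {k : ℕ} {S : IEMS k} {σF σE lamI : ℝ}

theorem aGen_eq (S : IEMS k) (θ : ℝ) : S.aGen θ = circleEval (genPoly S.a k) θ :=
  (circleEval_genPoly _ _ _).symm

theorem bGen_eq (S : IEMS k) (θ : ℝ) : S.bGen θ = circleEval (genPoly S.b (k + 1)) θ :=
  (circleEval_genPoly _ _ _).symm

theorem cGen_eq (S : IEMS k) (θ : ℝ) : S.cGen θ = circleEval (genPoly S.c k) θ :=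
  (circleEval_genPoly _ _ _).symm

/-- Zero-stability together with `a(θ) ≠ 0` excludes zeros of `∑ a_j z^j` in the closed disc. -/
theorem ZeroStable.aeval_ne_zero (hz : S.ZeroStable) (hk : 1 ≤ k) (ha : ∀ θ : ℝ, S.aGen θ ≠ 0)
    (z : ℂ) (hz1 : ‖z‖ ≤ 1) : Polynomial.aeval z (genPoly S.a k) ≠ 0 := by
  intro h
  rw [aeval_genPoly] at h
  have hz0 : z ≠ 0 := by
    rintro rfl
    rw [Finset.sum_eq_single 0] at h
    · simp [S.a_pos.ne'] at h
    · intro j _ hj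
      simp [hj]
    · intro h0
      exact absurd (Finset.mem_range.2 hk) h0
  -- The characteristic polynomial has the coefficients in reversed order, so a zero $z$ of $\sum
  -- a_jz^j$ becomes the root $1/z$. Zero-stability then excludes $|z|<1$, and $a(\theta)\ne0$
  -- excludes $|z|=1$.
  have hroot : S.charPolyA.IsRoot z⁻¹ := by
    rw [Polynomial.IsRoot.def, charPolyA, Polynomial.eval_mul, Polynomial.eval_finsetSum]
    simp only [Polynomial.eval_mul, Polynomial.eval_C, Polynomial.eval_pow, Polynomial.eval_X]
    have : ∑ j ∈ Finset.range k, (S.a j : ℂ) * z⁻¹ ^ (k - 1 - j) =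
        z⁻¹ ^ (k - 1) * ∑ j ∈ Finset.range k, (S.a j : ℂ) * z ^ j := by
      rw [Finset.mul_sum]
      refine Finset.sum_congr rfl fun j hj => ?_
      have hj' : k - 1 = (k - 1 - j) + j := by
        have := Finset.mem_range.1 hj
        omega
      conv_rhs => rw [hj', pow_add]
      have : z⁻¹ ^ j * z ^ j = 1 := by rw [← mul_pow, inv_mul_cancel₀ hz0, one_pow]
      linear_combination (-(S.a j : ℂ) * z⁻¹ ^ (k - 1 - j)) * this
    rw [this, h, mul_zero, mul_zero]
  have h1 := (hz _ hroot).1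
  rw [norm_inv] at h1
  have hzpos : 0 < ‖z‖ := norm_pos_iff.2 hz0
  have h2 : 1 ≤ ‖z‖ := by
    by_contra hlt
    exact absurd h1 (not_le.2 ((one_lt_inv₀ hzpos).2 (not_le.1 hlt)))
  have h3 : ‖z‖ = 1 := le_antisymm hz1 h2
  apply ha z.arg
  rw [aGen_eq, circleEval]
  have h4 := Complex.norm_mul_exp_arg_mul_I z
  rw [h3, Complex.ofReal_one, one_mul] at h4
  rw [h4, aeval_genPoly, h]

theorem mul_star_self_re (z : ℂ) : (z * star z).re = ‖z‖ ^ 2 := by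
  rw [Complex.star_def, Complex.mul_conj, Complex.ofReal_re, Complex.normSq_eq_norm_sq]

/-- The identity $b\bar a=(b/a)|a|^2$ clears the denominator, which puts the bound in the polynomial
form required by Parseval. -/
theorem HasIntensities.symbol_I (h : S.HasIntensities σF σE lamI) {θ : ℝ}
    (hθ : θ ∈ Set.Ico 0 (2 * Real.pi)) :
    lamI * (circleEval (genPoly S.a k) θ * star (circleEval (genPoly S.a k) θ)).re ≤
      (circleEval (genPoly S.b (k + 1)) θ * star (circleEval (genPoly S.a k) θ)).re := by
  rw [← aGen_eq, ← bGen_eq]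
  have h1 : lamI ≤ (S.bGen θ / S.aGen θ).re := h.isLeast_I.2 ⟨θ, hθ, rfl⟩
  have h2 : S.bGen θ * star (S.aGen θ) =
      (S.bGen θ / S.aGen θ) * ((‖S.aGen θ‖ ^ 2 : ℝ) : ℂ) := by
    rw [← Complex.normSq_eq_norm_sq, ← Complex.mul_conj, Complex.star_def, ← mul_assoc,
      div_mul_cancel₀ _ (h.aGen_ne_zero θ)]
  rw [h2, Complex.re_mul_ofReal, mul_star_self_re]
  exact mul_le_mul_of_nonneg_right h1 (sq_nonneg _)

theorem norm_sq_le_of_norm_div_le {x y : ℂ} {σ : ℝ} (hy : y ≠ 0) (h : ‖x / y‖ ≤ σ) :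
    ‖x‖ ^ 2 ≤ σ ^ 2 * ‖y‖ ^ 2 := by
  rw [norm_div, div_le_iff₀ (norm_pos_iff.2 hy)] at h
  rw [← mul_pow]
  exact pow_le_pow_left₀ (norm_nonneg _) h 2

theorem HasIntensities.symbol_E (h : S.HasIntensities σF σE lamI) {θ : ℝ}
    (hθ : θ ∈ Set.Ico 0 (2 * Real.pi)) :
    (circleEval (genPoly S.c k) θ * star (circleEval (genPoly S.c k) θ)).re ≤
      σE ^ 2 * (circleEval (genPoly S.a k) θ * star (circleEval (genPoly S.a k) θ)).re := by
  rw [← aGen_eq, ← cGen_eq, mul_star_self_re, mul_star_self_re]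
  exact norm_sq_le_of_norm_div_le (h.aGen_ne_zero θ) (h.isGreatest_E.2 ⟨θ, hθ, rfl⟩)

theorem HasIntensities.symbol_F (h : S.HasIntensities σF σE lamI) {θ : ℝ}
    (hθ : θ ∈ Set.Ico 0 (2 * Real.pi)) :
    (circleEval 1 θ * star (circleEval 1 θ)).re ≤
      σF ^ 2 * (circleEval (genPoly S.a k) θ * star (circleEval (genPoly S.a k) θ)).re := by
  have h1 : circleEval 1 θ = 1 := by simp [circleEval]
  rw [← aGen_eq, h1, mul_star_self_re, mul_star_self_re]
  exact norm_sq_le_of_norm_div_le (h.aGen_ne_zero θ) (h.isGreatest_F.2 ⟨θ, hθ, rfl⟩)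

end IEMS

/-! ### The energy norm and the dual norm -/

section Norms

variable {V : Type*} [NormedAddCommGroup V] [InnerProductSpace ℝ V] {L : V →L[ℝ] StrongDual ℝ V}

theorem IsPosDefSelfAdjoint.nonneg (hL : IsPosDefSelfAdjoint L) (v : V) : 0 ≤ L v v := by
  obtain ⟨α, hα, h⟩ := hL.coercive
  exact le_trans (by positivity) (h v)

theorem energyNorm_nonneg (L : V →L[ℝ] StrongDual ℝ V) (v : V) : 0 ≤ energyNorm L v :=
  Real.sqrt_nonneg _

theorem IsPosDefSelfAdjoint.energyNorm_sq (hL : IsPosDefSelfAdjoint L) (v : V) :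
    energyNorm L v ^ 2 = L v v :=
  Real.sq_sqrt (hL.nonneg v)

theorem energyNorm_neg (L : V →L[ℝ] StrongDual ℝ V) (v : V) :
    energyNorm L (-v) = energyNorm L v := by
  simp [energyNorm]

theorem energyNorm_sub_comm (L : V →L[ℝ] StrongDual ℝ V) (v w : V) :
    energyNorm L (v - w) = energyNorm L (w - v) := by
  rw [← energyNorm_neg, neg_sub]

theorem energyNorm_zero (L : V →L[ℝ] StrongDual ℝ V) : energyNorm L 0 = 0 := by
  simp [energyNorm]

theorem IsPosDefSelfAdjoint.exists_norm_le (hL : IsPosDefSelfAdjoint L) :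
    ∃ C : ℝ, 0 < C ∧ ∀ v, ‖v‖ ≤ C * energyNorm L v := by
  obtain ⟨α, hα, h⟩ := hL.coercive
  refine ⟨(Real.sqrt α)⁻¹, by positivity, fun v => ?_⟩
  have h1 : Real.sqrt α * ‖v‖ ≤ energyNorm L v := by
    refine Real.le_sqrt_of_sq_le ?_
    rw [mul_pow, Real.sq_sqrt hα.le]
    exact h v
  rw [inv_mul_eq_div, le_div_iff₀ (Real.sqrt_pos.2 hα), mul_comm]
  exact h1

theorem energyNorm_le_norm (L : V →L[ℝ] StrongDual ℝ V) (v : V) :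
    energyNorm L v ≤ Real.sqrt ‖L‖ * ‖v‖ := by
  rw [energyNorm, ← Real.sqrt_sq (norm_nonneg v), ← Real.sqrt_mul (norm_nonneg L)]
  refine Real.sqrt_le_sqrt ?_
  calc L v v ≤ ‖L v v‖ := le_abs_self _
    _ ≤ ‖L‖ * ‖v‖ * ‖v‖ := L.le_opNorm₂ v v
    _ = ‖L‖ * ‖v‖ ^ 2 := by ring

theorem IsPosDefSelfAdjoint.energyNorm_pos (hL : IsPosDefSelfAdjoint L) {v : V} (hv : v ≠ 0) :
    0 < energyNorm L v := by
  obtain ⟨C, hC, h⟩ := hL.exists_norm_le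
  have := (norm_pos_iff.2 hv).trans_le (h v)
  exact pos_of_mul_pos_right this hC.le

theorem dualNorm_nonneg (L : V →L[ℝ] StrongDual ℝ V) (f : StrongDual ℝ V) : 0 ≤ dualNorm L f :=
  Real.iSup_nonneg fun _ => div_nonneg (abs_nonneg _) (energyNorm_nonneg L _)

/-- The condition `0 ≤ C` covers the trivial space, where the supremum over the empty family is $0$.
-/
theorem IsPosDefSelfAdjoint.dualNorm_le (hL : IsPosDefSelfAdjoint L) {f : StrongDual ℝ V} {C : ℝ}
    (hC : 0 ≤ C) (h : ∀ w, |f w| ≤ C * energyNorm L w) : dualNorm L f ≤ C :=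
  Real.iSup_le (fun w => (div_le_iff₀ (hL.energyNorm_pos w.2)).2 (h w)) hC

theorem IsPosDefSelfAdjoint.exists_dualNorm_le (hL : IsPosDefSelfAdjoint L) :
    ∃ C : ℝ, 0 < C ∧ ∀ f, dualNorm L f ≤ C * ‖f‖ := by
  obtain ⟨C, hC, h⟩ := hL.exists_norm_le
  refine ⟨C, hC, fun f => hL.dualNorm_le (by positivity) fun w => ?_⟩
  calc |f w| ≤ ‖f‖ * ‖w‖ := f.le_opNorm w
    _ ≤ ‖f‖ * (C * energyNorm L w) := by gcongr; exact h w
    _ = C * ‖f‖ * energyNorm L w := by ring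

theorem IsPosDefSelfAdjoint.abs_apply_le (hL : IsPosDefSelfAdjoint L) (f : StrongDual ℝ V)
    (w : V) : |f w| ≤ dualNorm L f * energyNorm L w := by
  by_cases hw : w = 0
  · simp [hw, energyNorm_zero]
  obtain ⟨C, hC, h⟩ := hL.exists_norm_le
  rw [← div_le_iff₀ (hL.energyNorm_pos hw)]
  -- Coercivity bounds the family of quotients; a real supremum dominates its members only once
  -- boundedness is known.
  refine le_ciSup (f := fun w : {w : V // w ≠ 0} => |f w| / energyNorm L w) ?_ ⟨w, hw⟩
  refine ⟨‖f‖ * C, ?_⟩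
  rintro _ ⟨w, rfl⟩
  simp only
  rw [div_le_iff₀ (hL.energyNorm_pos w.2)]
  calc |f w| ≤ ‖f‖ * ‖(w : V)‖ := f.le_opNorm w
    _ ≤ ‖f‖ * (C * energyNorm L w) := by gcongr; exact h w
    _ = ‖f‖ * C * energyNorm L w := by ring

theorem IsPosDefSelfAdjoint.norm_le_dualNorm (hL : IsPosDefSelfAdjoint L) (f : StrongDual ℝ V) :
    ‖f‖ ≤ Real.sqrt ‖L‖ * dualNorm L f := by
  have h0 := dualNorm_nonneg L f
  refine f.opNorm_le_bound (by positivity) fun w => ?_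
  calc ‖f w‖ ≤ dualNorm L f * energyNorm L w := hL.abs_apply_le f w
    _ ≤ dualNorm L f * (Real.sqrt ‖L‖ * ‖w‖) := by gcongr; exact energyNorm_le_norm L w
    _ = Real.sqrt ‖L‖ * dualNorm L f * ‖w‖ := by ring

/-- Every functional is represented through `L` by a vector whose energy is controlled by the dual
norm. -/
theorem IsPosDefSelfAdjoint.exists_riesz [CompleteSpace V] (hL : IsPosDefSelfAdjoint L)
    (f : StrongDual ℝ V) : ∃ z : V, L z = f ∧ L z z ≤ dualNorm L f ^ 2 := by
  have hco : IsCoercive L := by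
    obtain ⟨α, hα, h⟩ := hL.coercive
    exact ⟨α, hα, fun v => by rw [mul_assoc, ← sq]; exact h v⟩
  set z : V := hco.continuousLinearEquivOfBilin.symm ((InnerProductSpace.toDual ℝ V).symm f)
    with hz
  have h1 : L z = f := by
    ext w
    rw [← hco.continuousLinearEquivOfBilin_apply, hz, ContinuousLinearEquiv.apply_symm_apply,
      InnerProductSpace.toDual_symm_apply]
  refine ⟨z, h1, ?_⟩
  have h2 : L z z ≤ dualNorm L f * energyNorm L z := by
    calc L z z = f z := by rw [h1]
      _ ≤ |f z| := le_abs_self _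
      _ ≤ _ := hL.abs_apply_le f z
  have h3 := hL.energyNorm_sq z
  nlinarith [sq_nonneg (dualNorm L f - energyNorm L z)]

theorem IsPosDefSelfAdjoint.young (hL : IsPosDefSelfAdjoint L) {s : ℝ} (hs : 0 < s) (v w : V) :
    L v w ≤ s / 2 * L v v + 1 / (2 * s) * L w w := by
  have h := hL.nonneg (s • v - w)
  simp only [map_sub, map_smul, sub_apply, smul_apply,
    smul_eq_mul] at h
  rw [hL.symm w v] at h
  have h2 : 2 * s * L v w ≤ s ^ 2 * L v v + L w w := by linarith
  have h3 : L v w ≤ (s ^ 2 * L v v + L w w) / (2 * s) := by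
    rw [le_div_iff₀ (by positivity)]
    linarith
  refine h3.trans (le_of_eq ?_)
  field_simp

/-- This is the only instance of the triangle inequality that is needed: two errors of size at most
one half combine into one in the unit ball. -/
theorem IsPosDefSelfAdjoint.energyNorm_add_le (hL : IsPosDefSelfAdjoint L) {v w : V}
    (hv : energyNorm L v ≤ 1 / 2) (hw : energyNorm L w ≤ 1 / 2) : energyNorm L (v + w) ≤ 1 := by
  refine Real.sqrt_le_iff.2 ⟨zero_le_one, ?_⟩
  have h1 := hL.energyNorm_sq v
  have h2 := hL.energyNorm_sq w
  have h3 := hL.young one_pos v w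
  have h4 : energyNorm L v ^ 2 ≤ (1 / 2) ^ 2 := pow_le_pow_left₀ (energyNorm_nonneg L v) hv 2
  have h5 : energyNorm L w ^ 2 ≤ (1 / 2) ^ 2 := pow_le_pow_left₀ (energyNorm_nonneg L w) hw 2
  simp only [map_add, add_apply]
  rw [hL.symm w v]
  linarith

end Norms

/-! ### The energy estimate -/

/-- The sum on the right stops before $m$, so no smallness of `c` is required: the geometric sum
closes the induction with $\Phi(1+c)^m$. -/
theorem discrete_gronwall_exp {E : ℕ → ℝ} {Φ c : ℝ} {M : ℕ} (hc : 0 ≤ c)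
    (h : ∀ m ≤ M, E m ≤ Φ + c * ∑ n ∈ Finset.range m, E n) (hΦ : 0 ≤ Φ) :
    ∀ m ≤ M, E m ≤ Φ * Real.exp (c * m) := by
  have h1 : ∀ m ≤ M, E m ≤ Φ * (1 + c) ^ m := by
    intro m
    induction m using Nat.strong_induction_on with
    | _ m ih =>
      intro hm
      have h2 : ∑ n ∈ Finset.range m, E n ≤ ∑ n ∈ Finset.range m, Φ * (1 + c) ^ n :=
        Finset.sum_le_sum fun n hn =>
          ih n (Finset.mem_range.1 hn) ((Finset.mem_range.1 hn).le.trans hm)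
      have h3 : c * ∑ n ∈ Finset.range m, (1 + c) ^ n = (1 + c) ^ m - 1 := by
        have := mul_geom_sum (1 + c) m
        rwa [add_sub_cancel_left] at this
      calc E m ≤ Φ + c * ∑ n ∈ Finset.range m, E n := h m hm
        _ ≤ Φ + c * ∑ n ∈ Finset.range m, Φ * (1 + c) ^ n := by gcongr
        _ = Φ * (1 + c) ^ m := by
          rw [← Finset.mul_sum]
          linear_combination Φ * h3
  intro m hm
  refine (h1 m hm).trans (mul_le_mul_of_nonneg_left ?_ hΦ)
  calc (1 + c) ^ m ≤ Real.exp c ^ m := by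
        refine pow_le_pow_left₀ (by positivity) ?_ m
        rw [add_comm]
        exact Real.add_one_le_exp c
    _ = Real.exp (c * m) := by rw [← Real.exp_nat_mul, mul_comm]

section Energy

variable {V H : Type*} [NormedAddCommGroup V] [InnerProductSpace ℝ V]
  [NormedAddCommGroup H] [InnerProductSpace ℝ H] {ι : V →L[ℝ] H} {L : V →L[ℝ] StrongDual ℝ V}

theorem toDualV_apply (ι : V →L[ℝ] H) (v w : V) : toDualV ι v w = inner ℝ (ι v) (ι w) := rfl

theorem toDualV_sub (ι : V →L[ℝ] H) (v w : V) :
    toDualV ι (v - w) = toDualV ι v - toDualV ι w := by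
  ext z
  simp [toDualV_apply, inner_sub_left]

/-- The backward difference quotient of `e`, extended by zero to the initial index. -/
noncomputable def backwardDiff (ι : V →L[ℝ] H) (τ : ℝ) (e : ℕ → V) (n : ℕ) : StrongDual ℝ V :=
  τ⁻¹ • (toDualV ι (e n) - toDualV ι (e (n - 1)))

/-- Telescoping of $\langle e^n-e^{n-1},e^n\rangle\ge\frac12\|e^n\|^2-\frac12\|e^{n-1}\|^2$. The
index $n=0$ contributes nothing, because `0 - 1 = 0` in the natural numbers. -/
theorem half_norm_sq_sub_le_sum_backwardDiff {τ : ℝ} (hτ : 0 < τ) (e : ℕ → V) (m : ℕ) :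
    1 / 2 * ‖ι (e m)‖ ^ 2 - 1 / 2 * ‖ι (e 0)‖ ^ 2 ≤
      τ * ∑ n ∈ Finset.range (m + 1), backwardDiff ι τ e n (e n) := by
  induction m with
  | zero => simp [backwardDiff]
  | succ m ih =>
    rw [Finset.sum_range_succ, mul_add]
    have h1 : τ * backwardDiff ι τ e (m + 1) (e (m + 1)) =
        ‖ι (e (m + 1))‖ ^ 2 - inner ℝ (ι (e m)) (ι (e (m + 1))) := by
      simp only [backwardDiff, Nat.add_sub_cancel, smul_apply,
        sub_apply, toDualV_apply, smul_eq_mul, real_inner_self_eq_norm_sq]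
      rw [← mul_assoc, mul_inv_cancel₀ hτ.ne', one_mul]
    have h2 : inner ℝ (ι (e m)) (ι (e (m + 1))) ≤
        1 / 2 * ‖ι (e m)‖ ^ 2 + 1 / 2 * ‖ι (e (m + 1))‖ ^ 2 := by
      have := real_inner_le_norm (ι (e m)) (ι (e (m + 1)))
      nlinarith [sq_nonneg (‖ι (e m)‖ - ‖ι (e (m + 1))‖)]
    rw [h1]
    linarith

/-- Convolving the error equation with the inverse of `∑ a_j z^j` and testing with the error. -/
theorem energy_inequality (hL : IsPosDefSelfAdjoint L) {α β γ : Polynomial ℝ} {r : PowerSeries ℝ}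
    (hr : r * (α : PowerSeries ℝ) = 1)
    (hr0 : Filter.Tendsto (fun n => PowerSeries.coeff n r) Filter.atTop (nhds 0))
    {lamI σE σF : ℝ}
    (hI : ∀ θ ∈ Set.Ico 0 (2 * Real.pi), lamI * (circleEval α θ * star (circleEval α θ)).re ≤
      (circleEval β θ * star (circleEval α θ)).re)
    (hE : ∀ θ ∈ Set.Ico 0 (2 * Real.pi), (circleEval γ θ * star (circleEval γ θ)).re ≤
      σE ^ 2 * (circleEval α θ * star (circleEval α θ)).re)
    (hF : ∀ θ ∈ Set.Ico 0 (2 * Real.pi), (circleEval 1 θ * star (circleEval 1 θ)).re ≤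
      σF ^ 2 * (circleEval α θ * star (circleEval α θ)).re)
    {ϖ τ : ℝ} (hϖ : 0 < ϖ) (hτ : 0 < τ) {e g δ : ℕ → V} {m : ℕ}
    (heq : ∀ n ≤ m, seqConv (α : PowerSeries ℝ) (backwardDiff ι τ e) n +
      ϖ • seqConv (β : PowerSeries ℝ) (fun j => L (e j)) n =
      seqConv (γ : PowerSeries ℝ) (fun j => L (g j)) n + L (δ n))
    {s t : ℝ} (hs : 0 < s) (ht : 0 < t) :
    1 / 2 * ‖ι (e m)‖ ^ 2 - 1 / 2 * ‖ι (e 0)‖ ^ 2 +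
        τ * (ϖ * (lamI * ∑ n ∈ Finset.range (m + 1), L (e n) (e n))) ≤
      τ * (s / 2 * (σE ^ 2 * ∑ n ∈ Finset.range (m + 1), L (g n) (g n)) +
        1 / (2 * s) * ∑ n ∈ Finset.range (m + 1), L (e n) (e n) +
        t / 2 * (σF ^ 2 * ∑ n ∈ Finset.range (m + 1), L (δ n) (δ n)) +
        1 / (2 * t) * ∑ n ∈ Finset.range (m + 1), L (e n) (e n)) := by
  have hB := hL.symm
  have hB0 := hL.nonneg
  -- Convolution with `r` isolates the difference quotient; what remains are the symbols
  -- $\beta/\alpha$, $\gamma/\alpha$ and $1/\alpha$.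
  have h1 : ∀ n ≤ m, backwardDiff ι τ e n + ϖ • L (seqConv (r * (β : PowerSeries ℝ)) e n) =
      L (seqConv (r * (γ : PowerSeries ℝ)) g n) + L (seqConv r δ n) := by
    intro n hn
    have h2 : seqConv r (fun n => seqConv (α : PowerSeries ℝ) (backwardDiff ι τ e) n +
        ϖ • seqConv (β : PowerSeries ℝ) (fun j => L (e j)) n) n = seqConv r (fun n =>
        seqConv (γ : PowerSeries ℝ) (fun j => L (g j)) n + L (δ n)) n :=
      seqConv_congr fun j hj => heq j (hj.trans hn)
    rw [seqConv_add, seqConv_add, seqConv_smul, ← seqConv_mul, ← seqConv_mul, ← seqConv_mul, hr,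
      seqConv_one] at h2
    have h3 := map_seqConv (L : V →ₗ[ℝ] StrongDual ℝ V)
    simp only [ContinuousLinearMap.coe_coe] at h3
    rw [h3, h3, h3] at h2
    exact h2
  have h2 := half_norm_sq_sub_le_sum_backwardDiff (ι := ι) hτ e m
  have h3 := coercive_seqConv_div hB hB0 hr hr0 hI e m
  have h4 := bounded_seqConv_div hB hB0 hr hr0 hE g m
  have h5 := bounded_seqConv_div hB hB0 hr hr0 hF δ m
  rw [Polynomial.coe_one, mul_one] at h5
  have h6 : ∑ n ∈ Finset.range (m + 1), backwardDiff ι τ e n (e n) +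
      ϖ * ∑ n ∈ Finset.range (m + 1), L (seqConv (r * (β : PowerSeries ℝ)) e n) (e n) ≤
      s / 2 * ∑ n ∈ Finset.range (m + 1), L (seqConv (r * (γ : PowerSeries ℝ)) g n)
        (seqConv (r * (γ : PowerSeries ℝ)) g n) +
      1 / (2 * s) * ∑ n ∈ Finset.range (m + 1), L (e n) (e n) +
      t / 2 * ∑ n ∈ Finset.range (m + 1), L (seqConv r δ n) (seqConv r δ n) +
      1 / (2 * t) * ∑ n ∈ Finset.range (m + 1), L (e n) (e n) := by
    simp only [Finset.mul_sum]
    rw [← Finset.sum_add_distrib, ← Finset.sum_add_distrib, ← Finset.sum_add_distrib,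
      ← Finset.sum_add_distrib]
    refine Finset.sum_le_sum fun n hn => ?_
    have h7 := congrArg (fun f : StrongDual ℝ V => f (e n))
      (h1 n (Nat.lt_succ_iff.1 (Finset.mem_range.1 hn)))
    simp only [add_apply, smul_apply, smul_eq_mul] at h7
    rw [h7]
    have h8 := hL.young hs (seqConv (r * (γ : PowerSeries ℝ)) g n) (e n)
    have h9 := hL.young ht (seqConv r δ n) (e n)
    linarith
  have h7 := mul_le_mul_of_nonneg_left h3 hϖ.le
  have h8 := mul_le_mul_of_nonneg_left h4 (by positivity : 0 ≤ s / 2)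
  have h9 := mul_le_mul_of_nonneg_left h5 (by positivity : 0 ≤ t / 2)
  refine (add_le_add_left h2 _).trans ?_
  rw [← mul_add]
  refine mul_le_mul_of_nonneg_left ?_ hτ.le
  linarith

/-- Young's inequality $(x+y)^2\le(1+\eta)x^2+(1+1/\eta)y^2$ with small $\eta$ keeps the factor of
$\mu_0^2$ nearly sharp. The shift in `g` leaves only $H$-norms with index below $m$, as Gronwall's
inequality requires. -/
theorem sum_range_succ_sq_le {g e : ℕ → V} {μ₀ μ : ℝ} (hL : IsPosDefSelfAdjoint L)
    {m : ℕ} (hg0 : g 0 = 0) {η : ℝ} (hη : 0 < η)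
    (hg : ∀ n < m, L (g (n + 1)) (g (n + 1)) ≤
      (μ₀ * energyNorm L (e n) + μ * ‖ι (e n)‖) ^ 2) :
    ∑ n ∈ Finset.range (m + 1), L (g n) (g n) ≤
      (1 + η) * μ₀ ^ 2 * ∑ n ∈ Finset.range (m + 1), L (e n) (e n) +
        (1 + 1 / η) * μ ^ 2 * ∑ n ∈ Finset.range m, ‖ι (e n)‖ ^ 2 := by
  rw [Finset.sum_range_succ', hg0, map_zero, add_zero]
  have h0 : ∑ n ∈ Finset.range m, L (e n) (e n) ≤ ∑ n ∈ Finset.range (m + 1), L (e n) (e n) :=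
    Finset.sum_le_sum_of_subset_of_nonneg (Finset.range_subset_range.2 (Nat.le_succ m))
      fun n _ _ => hL.nonneg _
  refine le_trans ?_ (add_le_add_left
    (mul_le_mul_of_nonneg_left h0 (by positivity : 0 ≤ (1 + η) * μ₀ ^ 2)) _)
  rw [Finset.mul_sum, Finset.mul_sum, ← Finset.sum_add_distrib]
  refine Finset.sum_le_sum fun n hn => (hg n (Finset.mem_range.1 hn)).trans ?_
  rw [← hL.energyNorm_sq]
  set x := μ₀ * energyNorm L (e n) with hx
  set y := μ * ‖ι (e n)‖ with hy
  have h1 : 2 * x * y ≤ η * x ^ 2 + 1 / η * y ^ 2 := by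
    have h2 := sq_nonneg (η * x - y)
    have h3 : 2 * x * y ≤ (η ^ 2 * x ^ 2 + y ^ 2) / η := by
      rw [le_div_iff₀ hη]
      nlinarith
    refine h3.trans (le_of_eq ?_)
    field_simp
  have h2 : (1 + η) * μ₀ ^ 2 * energyNorm L (e n) ^ 2 = (1 + η) * x ^ 2 := by rw [hx]; ring
  have h3 : (1 + 1 / η) * μ ^ 2 * ‖ι (e n)‖ ^ 2 = (1 + 1 / η) * y ^ 2 := by rw [hy]; ring
  rw [h2, h3]
  linarith [add_sq x y]

theorem stabilityMargin_pos {ϖ μ₀ σE lamI : ℝ} (hϖ : 0 < ϖ) (hμ₀ : 0 ≤ μ₀) (hσE : 0 < σE)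
    (hlam : 0 < lamI) (h : lamI / σE > μ₀ / ϖ) : 0 < stabilityMargin ϖ μ₀ σE lamI := by
  have h1 : σE * μ₀ < lamI * ϖ := by
    rw [gt_iff_lt, div_lt_div_iff₀ hϖ hσE] at h
    linarith
  have h2 : (σE * μ₀) ^ 2 < (lamI * ϖ) ^ 2 := pow_lt_pow_left₀ h1 (by positivity) two_ne_zero
  have h3 : (σE * μ₀) ^ 2 / (2 * (lamI * ϖ) ^ 2) < 1 / 2 := by
    rw [div_lt_div_iff₀ (by positivity) two_pos]
    linarith
  unfold stabilityMargin
  linarith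

/-- The energy inequality after absorbing all terms of highest order. -/
theorem energy_inequality_absorbed {ϖ μ₀ σE lamI σF μ τ ε : ℝ} (hϖ : 0 < ϖ) (hσE : 0 < σE)
    (hlam : 0 < lamI) (hε : ε = stabilityMargin ϖ μ₀ σE lamI) (hε0 : 0 < ε) (hτ : 0 < τ)
    {x y S G h D : ℝ} (hS : 0 ≤ S)
    (h1 : 1 / 2 * x - 1 / 2 * y + τ * (ϖ * (lamI * S)) ≤
      τ * (1 / (lamI * ϖ) / 2 * (σE ^ 2 * G) + 1 / (2 * (1 / (lamI * ϖ))) * S +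
        2 / (lamI * ϖ * ε) / 2 * (σF ^ 2 * D) + 1 / (2 * (2 / (lamI * ϖ * ε))) * S))
    (h2 : G ≤ (1 + ε / 2) * μ₀ ^ 2 * S + (1 + 1 / (ε / 2)) * μ ^ 2 * h) :
    x + ε * lamI * ϖ * (τ * S) ≤ y +
      (σE ^ 2 * (1 + 2 / ε) * μ ^ 2 / (lamI * ϖ) * (τ * h) +
        2 * σF ^ 2 / (lamI * ϖ * ε) * (τ * D)) := by
  set κ := lamI * ϖ with hκ
  have hκ0 : 0 < κ := by positivity
  -- The definition of $\varepsilon$ solved for $(\sigma_E\mu_0)^2$.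
  have hx : (σE * μ₀) ^ 2 = κ ^ 2 * (1 - 2 * ε) := by
    rw [hε, stabilityMargin, ← hκ]
    field_simp
    ring
  have h3 : 1 / κ / 2 * (σE ^ 2 * G) ≤
      1 / κ / 2 * (σE ^ 2 * ((1 + ε / 2) * μ₀ ^ 2 * S + (1 + 1 / (ε / 2)) * μ ^ 2 * h)) := by
    gcongr
  have h4 : 1 / κ / 2 * (σE ^ 2 * ((1 + ε / 2) * μ₀ ^ 2 * S + (1 + 1 / (ε / 2)) * μ ^ 2 * h)) =
      κ / 2 * (1 - 2 * ε) * (1 + ε / 2) * S +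
        1 / 2 * (σE ^ 2 * (1 + 2 / ε) * μ ^ 2 / κ * h) := by
    have : 1 / κ / 2 * (σE ^ 2 * ((1 + ε / 2) * μ₀ ^ 2 * S + (1 + 1 / (ε / 2)) * μ ^ 2 * h)) =
      1 / κ / 2 * ((σE * μ₀) ^ 2 * (1 + ε / 2) * S) +
        1 / 2 * (σE ^ 2 * (1 + 1 / (ε / 2)) * μ ^ 2 / κ * h) := by
      field_simp
    rw [this, hx]
    field_simp
  have h5 : 1 / (2 * (1 / κ)) = κ / 2 := by field_simp
  have h6 : 1 / (2 * (2 / (κ * ε))) = κ * ε / 4 := by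
    field_simp
    norm_num
  have h7 : 2 / (κ * ε) / 2 * (σF ^ 2 * D) = 1 / 2 * (2 * σF ^ 2 / (κ * ε) * D) := by
    field_simp
  rw [h5, h6, h7] at h1
  rw [h4] at h3
  set Y := σE ^ 2 * (1 + 2 / ε) * μ ^ 2 / κ * h with hY
  set Z := 2 * σF ^ 2 / (κ * ε) * D with hZ
  -- The left side equals $\kappa S-\frac{\kappa\varepsilon}2S-\frac{\kappa\varepsilon^2}2S$. The
  -- surplus $\frac{\kappa\varepsilon}2S$ becomes the $V$-term of the discrete energy after
  -- multiplication by $2$.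
  have h8 : κ / 2 * (1 - 2 * ε) * (1 + ε / 2) * S + κ / 2 * S + κ * ε / 4 * S ≤
      κ * S - κ * ε / 2 * S := by
    have : 0 ≤ κ * S * ε ^ 2 := by positivity
    nlinarith
  have h9 : 1 / 2 * x - 1 / 2 * y + τ * (κ * S) ≤
      τ * (κ * S - κ * ε / 2 * S + 1 / 2 * Y + 1 / 2 * Z) := by
    have e1 : ϖ * (lamI * S) = κ * S := by rw [hκ]; ring
    rw [e1] at h1
    refine h1.trans (mul_le_mul_of_nonneg_left ?_ hτ.le)
    linarith
  have e2 : σE ^ 2 * (1 + 2 / ε) * μ ^ 2 / κ * (τ * h) = τ * Y := by rw [hY]; ring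
  have e3 : 2 * σF ^ 2 / (κ * ε) * (τ * D) = τ * Z := by rw [hZ]; ring
  have e4 : ε * lamI * ϖ * (τ * S) = τ * (κ * ε * S) := by rw [hκ]; ring
  rw [e2, e3, e4]
  nlinarith

end Energy

/-! ### Stability estimate for the multistep scheme -/

section Stability

variable {V H : Type*} [NormedAddCommGroup V] [InnerProductSpace ℝ V]
  [NormedAddCommGroup H] [InnerProductSpace ℝ H] {ι : V →L[ℝ] H} {L : V →L[ℝ] StrongDual ℝ V}
  {k : ℕ} {S : IEMS k}

theorem backwardDiff_zero (ι : V →L[ℝ] H) (τ : ℝ) (e : ℕ → V) : backwardDiff ι τ e 0 = 0 := by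
  simp [backwardDiff]

/-- The difference of two residuals in convolution form. -/
theorem IEMS.residual_sub_residual (S : IEMS k) (ι : V →L[ℝ] H) (L : V →L[ℝ] StrongDual ℝ V)
    (F : V → StrongDual ℝ V) (ϖ τ : ℝ) (corr : ℕ → StrongDual ℝ V) (v U : ℕ → V) (n : ℕ) :
    S.residual ι L F ϖ τ corr v n - S.residual ι L F ϖ τ corr U n =
      seqConv (genPoly S.a k : PowerSeries ℝ) (backwardDiff ι τ fun j => v j - U j) n +
      ϖ • seqConv (genPoly S.b (k + 1) : PowerSeries ℝ) (fun j => L (v j - U j)) n -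
      seqConv (genPoly S.c k : PowerSeries ℝ)
        (fun j => if j = 0 then 0 else F (v (j - 1)) - F (U (j - 1))) n := by
  rw [seqConv_genPoly_of_zero _ _ (backwardDiff_zero ι τ _), seqConv_genPoly,
    seqConv_genPoly_of_zero (y := fun j => if j = 0 then 0 else F (v (j - 1)) - F (U (j - 1))) _ _
      (if_pos rfl)]
  have hA : ∑ j ∈ (Finset.range k).filter (fun j => j < n),
      S.a j • backwardDiff ι τ (fun j => v j - U j) (n - j) =
      ∑ j ∈ (Finset.range k).filter (fun j => j < n),
        S.a j • (τ⁻¹ • (toDualV ι (v (n - j)) - toDualV ι (v (n - j - 1)))) -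
      ∑ j ∈ (Finset.range k).filter (fun j => j < n),
        S.a j • (τ⁻¹ • (toDualV ι (U (n - j)) - toDualV ι (U (n - j - 1)))) := by
    rw [← Finset.sum_sub_distrib]
    refine Finset.sum_congr rfl fun j _ => ?_
    rw [backwardDiff, toDualV_sub, toDualV_sub]
    module
  have hB : ∑ j ∈ (Finset.range (k + 1)).filter (fun j => j ≤ n),
      S.b j • L (v (n - j) - U (n - j)) =
      ∑ j ∈ (Finset.range (k + 1)).filter (fun j => j ≤ n), S.b j • L (v (n - j)) -
      ∑ j ∈ (Finset.range (k + 1)).filter (fun j => j ≤ n), S.b j • L (U (n - j)) := by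
    rw [← Finset.sum_sub_distrib]
    refine Finset.sum_congr rfl fun j _ => ?_
    rw [map_sub, smul_sub]
  have hC : ∑ j ∈ (Finset.range k).filter (fun j => j < n),
      S.c j • (if n - j = 0 then 0 else F (v (n - j - 1)) - F (U (n - j - 1))) =
      ∑ j ∈ (Finset.range k).filter (fun j => j < n), S.c j • F (v (n - j - 1)) -
      ∑ j ∈ (Finset.range k).filter (fun j => j < n), S.c j • F (U (n - j - 1)) := by
    rw [← Finset.sum_sub_distrib]
    refine Finset.sum_congr rfl fun j hj => ?_
    rw [if_neg (by have := (Finset.mem_filter.1 hj).2; omega), smul_sub]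
  rw [hA, hB, hC, smul_sub]
  unfold IEMS.residual
  abel

/-- Stability of the scheme as long as the Lipschitz estimate is available along both sequences. -/
theorem IEMS.exists_stability_constant [CompleteSpace V] (hL : IsPosDefSelfAdjoint L)
    (F : V → StrongDual ℝ V) {ϖ T μ₀ μ : ℝ} (hϖ : 0 < ϖ) (hk : 1 ≤ k) (hμ₀ : 0 ≤ μ₀)
    (hzero : S.ZeroStable) {σF σE lamI : ℝ} (hS : S.HasIntensities σF σE lamI)
    (hstab : lamI / σE > μ₀ / ϖ) :
    ∃ K : ℝ, 0 < K ∧ ∀ (τ : ℝ) (M : ℕ), 0 < τ → M * τ ≤ T →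
      ∀ (corr : ℕ → StrongDual ℝ V) (v U : ℕ → V) (d : ℕ → StrongDual ℝ V),
      (∀ n < M, dualNorm L (F (v n) - F (U n)) ≤
        μ₀ * energyNorm L (v n - U n) + μ * ‖ι (v n - U n)‖) →
      (∀ n, 1 ≤ n → n ≤ M →
        S.residual ι L F ϖ τ corr v n - S.residual ι L F ϖ τ corr U n = d n) →
      discreteEnergy ι L (stabilityMargin ϖ μ₀ σE lamI) lamI ϖ τ (fun j => v j - U j) M ≤
        K * perturbationSize ι L τ (v 0 - U 0) d M := by
  obtain ⟨r, hr, hr0⟩ := exists_inverse_tendsto_zero (genPoly S.a k)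
    (hzero.aeval_ne_zero hk hS.aGen_ne_zero)
  set ε := stabilityMargin ϖ μ₀ σE lamI with hε
  have hσE := hS.E_pos
  have hσF := hS.F_pos
  have hlam := hS.I_pos
  have hε0 : 0 < ε := stabilityMargin_pos hϖ hμ₀ hσE hlam hstab
  set C₁ := σE ^ 2 * (1 + 2 / ε) * μ ^ 2 / (lamI * ϖ) with hC₁
  set C₂ := 2 * σF ^ 2 / (lamI * ϖ * ε) with hC₂
  have hC₁0 : 0 ≤ C₁ := by positivity
  have hC₂0 : 0 ≤ C₂ := by positivity
  -- The exponential comes from Gronwall's inequality on $[0,T]$, and $(\varpi b_0)^2$ from the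
  -- equation at index $0$.
  refine ⟨(1 + C₂ * (1 + (ϖ * S.b 0) ^ 2)) * Real.exp (C₁ * T), by positivity, ?_⟩
  intro τ M hτ hMT corr v U d hLip hres
  -- Functionals are replaced by their representatives under `L`, so that every convolution estimate
  -- concerns the single form $\langle\mathcal L\cdot,\cdot\rangle$ on $V$.
  choose R hR1 hR2 using hL.exists_riesz
  set e : ℕ → V := fun j => v j - U j with he
  set g : ℕ → V := fun n => if n = 0 then 0 else R (F (v (n - 1)) - F (U (n - 1))) with hg
  -- The scheme says nothing at $n=0$. There the difference quotient and the explicit term vanish,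
  -- so the defect is $\varpi b_0\mathcal Le^0$; this is the source of $\tau\|e^0\|_V^2$ in
  -- `perturbationSize`.
  set δ : ℕ → V := fun n => if n = 0 then (ϖ * S.b 0) • e 0 else R (d n) with hδ
  have hLg : (fun j => L (g j)) =
      fun j => if j = 0 then 0 else F (v (j - 1)) - F (U (j - 1)) := by
    funext j
    simp only [hg]
    split_ifs
    · simp
    · rw [hR1]
  have heq : ∀ n ≤ M, seqConv (genPoly S.a k : PowerSeries ℝ) (backwardDiff ι τ e) n +
      ϖ • seqConv (genPoly S.b (k + 1) : PowerSeries ℝ) (fun j => L (e j)) n =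
      seqConv (genPoly S.c k : PowerSeries ℝ) (fun j => L (g j)) n + L (δ n) := by
    intro n hn
    rcases Nat.eq_zero_or_pos n with rfl | hn1
    · rw [hLg, seqConv_genPoly_of_zero _ _ (backwardDiff_zero ι τ _), seqConv_genPoly,
        seqConv_genPoly_of_zero
          (y := fun j => if j = 0 then 0 else F (v (j - 1)) - F (U (j - 1))) _ _ (if_pos rfl)]
      simp [hδ, smul_smul]
    · have h1 := S.residual_sub_residual ι L F ϖ τ corr v U n
      rw [hres n hn1 hn] at h1
      have h2 : L (δ n) = d n := by
        simp only [hδ, if_neg hn1.ne']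
        exact hR1 _
      rw [h2, h1, hLg]
      abel
  have hg2 : ∀ n < M, L (g (n + 1)) (g (n + 1)) ≤
      (μ₀ * energyNorm L (e n) + μ * ‖ι (e n)‖) ^ 2 := by
    intro n hn
    have h1 : g (n + 1) = R (F (v n) - F (U n)) := by simp [hg]
    rw [h1]
    exact (hR2 _).trans (pow_le_pow_left₀ (dualNorm_nonneg L _) (hLip n hn) 2)
  set E : ℕ → ℝ := fun n => discreteEnergy ι L ε lamI ϖ τ e n with hE
  set Φ : ℝ := ‖ι (e 0)‖ ^ 2 + C₂ * (τ * ∑ n ∈ Finset.range (M + 1), L (δ n) (δ n)) with hΦ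
  have hδ0 : 0 ≤ ∑ n ∈ Finset.range (M + 1), L (δ n) (δ n) :=
    Finset.sum_nonneg fun n _ => hL.nonneg _
  have hΦ0 : 0 ≤ Φ := by positivity
  have hsum : ∀ m, ∑ j ∈ Finset.Icc 1 m, τ * energyNorm L (e j) ^ 2 ≤
      τ * ∑ n ∈ Finset.range (m + 1), L (e n) (e n) := by
    intro m
    rw [← Finset.mul_sum]
    refine mul_le_mul_of_nonneg_left ?_ hτ.le
    simp only [hL.energyNorm_sq]
    refine Finset.sum_le_sum_of_subset_of_nonneg ?_ fun n _ _ => hL.nonneg _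
    intro j hj
    rw [Finset.mem_Icc] at hj
    rw [Finset.mem_range]
    omega
  have hHE : ∀ n, ‖ι (e n)‖ ^ 2 ≤ E n := by
    intro n
    simp only [hE, discreteEnergy]
    have : 0 ≤ ε * lamI * ϖ * ∑ j ∈ Finset.Icc 1 n, τ * energyNorm L (e j) ^ 2 :=
      mul_nonneg (by positivity) (Finset.sum_nonneg fun j _ => by positivity)
    linarith
  have hgron : ∀ m ≤ M, E m ≤ Φ + C₁ * τ * ∑ n ∈ Finset.range m, E n := by
    intro m hm
    have h1 := energy_inequality (ι := ι) hL hr hr0 (β := genPoly S.b (k + 1))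
      (γ := genPoly S.c k) (lamI := lamI) (σE := σE) (σF := σF)
      (fun θ hθ => hS.symbol_I hθ) (fun θ hθ => hS.symbol_E hθ) (fun θ hθ => hS.symbol_F hθ)
      -- The weight `s` balances the explicit term against coercivity. The choice of `t`, together
      -- with the Lipschitz weight $\varepsilon/2$ below, consumes only part of the margin.
      hϖ hτ (e := e) (g := g) (δ := δ) (m := m) (fun n hn => heq n (hn.trans hm))
      (s := 1 / (lamI * ϖ)) (t := 2 / (lamI * ϖ * ε)) (by positivity) (by positivity)
    have h2 := sum_range_succ_sq_le (ι := ι) (g := g) (e := e) hL (m := m)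
      (by simp [hg]) (half_pos hε0) (fun n hn => hg2 n (hn.trans_le hm))
    have h3 := energy_inequality_absorbed hϖ hσE hlam hε hε0 hτ
      (Finset.sum_nonneg fun n _ => hL.nonneg (e n)) h1 h2
    have h4 : ∑ n ∈ Finset.range m, ‖ι (e n)‖ ^ 2 ≤ ∑ n ∈ Finset.range m, E n :=
      Finset.sum_le_sum fun n _ => hHE n
    have h5 : ∑ n ∈ Finset.range (m + 1), L (δ n) (δ n) ≤
        ∑ n ∈ Finset.range (M + 1), L (δ n) (δ n) :=
      Finset.sum_le_sum_of_subset_of_nonneg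
        (Finset.range_subset_range.2 (Nat.succ_le_succ hm)) fun n _ _ => hL.nonneg _
    calc E m ≤ ‖ι (e m)‖ ^ 2 + ε * lamI * ϖ *
          (τ * ∑ n ∈ Finset.range (m + 1), L (e n) (e n)) := by
          simp only [hE, discreteEnergy]
          have := mul_le_mul_of_nonneg_left (hsum m) (by positivity : 0 ≤ ε * lamI * ϖ)
          linarith
      _ ≤ _ := h3
      _ ≤ ‖ι (e 0)‖ ^ 2 + (C₁ * (τ * ∑ n ∈ Finset.range m, E n) +
          C₂ * (τ * ∑ n ∈ Finset.range (M + 1), L (δ n) (δ n))) := by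
          gcongr
      _ = Φ + C₁ * τ * ∑ n ∈ Finset.range m, E n := by rw [hΦ]; ring
  have h1 := discrete_gronwall_exp (by positivity) hgron hΦ0 M le_rfl
  have h2 : Real.exp (C₁ * τ * M) ≤ Real.exp (C₁ * T) := by
    refine Real.exp_le_exp.2 ?_
    rw [mul_assoc, mul_comm τ]
    exact mul_le_mul_of_nonneg_left hMT hC₁0
  have h3 : Φ ≤ (1 + C₂ * (1 + (ϖ * S.b 0) ^ 2)) * perturbationSize ι L τ (e 0) d M := by
    have h4 : τ * ∑ n ∈ Finset.range (M + 1), L (δ n) (δ n) ≤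
        (ϖ * S.b 0) ^ 2 * (τ * energyNorm L (e 0) ^ 2) +
          ∑ i ∈ Finset.Icc 1 M, τ * dualNorm L (d i) ^ 2 := by
      rw [Finset.sum_range_succ', ← Finset.mul_sum, mul_add, add_comm]
      refine add_le_add (le_of_eq ?_) (mul_le_mul_of_nonneg_left ?_ hτ.le)
      · simp only [hδ, if_true, map_smul, smul_apply, smul_eq_mul,
          hL.energyNorm_sq]
        ring
      · have hIcc : Finset.Icc 1 M = Finset.Ico 1 (M + 1) := by
          ext j
          simp only [Finset.mem_Icc, Finset.mem_Ico]
          omega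
        rw [hIcc, Finset.sum_Ico_eq_sum_range, Nat.add_sub_cancel]
        refine Finset.sum_le_sum fun n _ => ?_
        have : δ (n + 1) = R (d (n + 1)) := by simp [hδ]
        rw [this, add_comm 1 n]
        exact hR2 _
    have h5 : 0 ≤ ∑ i ∈ Finset.Icc 1 M, τ * dualNorm L (d i) ^ 2 :=
      Finset.sum_nonneg fun i _ => by positivity
    have h6 : 0 ≤ τ * energyNorm L (e 0) ^ 2 := by positivity
    have h7 : 0 ≤ ‖ι (e 0)‖ ^ 2 := by positivity
    rw [hΦ, perturbationSize]
    set X := τ * energyNorm L (e 0) ^ 2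
    set Y := ∑ i ∈ Finset.Icc 1 M, τ * dualNorm L (d i) ^ 2
    set w := (ϖ * S.b 0) ^ 2
    set Z := ‖ι (e 0)‖ ^ 2
    have hw : 0 ≤ w := sq_nonneg _
    have h8 := mul_le_mul_of_nonneg_left h4 hC₂0
    have h9 : 0 ≤ X + Y + C₂ * (Z + X + w * Z + w * Y) := by positivity
    linarith
  calc discreteEnergy ι L ε lamI ϖ τ e M ≤ Φ * Real.exp (C₁ * τ * M) := h1
    _ ≤ ((1 + C₂ * (1 + (ϖ * S.b 0) ^ 2)) * perturbationSize ι L τ (e 0) d M) *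
        Real.exp (C₁ * T) :=
        mul_le_mul h3 h2 (Real.exp_pos _).le (hΦ0.trans h3)
    _ = _ := by ring

end Stability

/-! ### Consistency -/

section Consistency

variable {E : Type*} [NormedAddCommGroup E] [NormedSpace ℝ E]

theorem iteratedDerivWithin_Icc_subset {g : ℝ → E} {T s y : ℝ} {i : ℕ} (hs : 0 ≤ s) (hsT : s < T)
    (hg : ContDiffOn ℝ i g (Set.Icc 0 T)) (hy : y ∈ Set.Icc s T) :
    iteratedDerivWithin i g (Set.Icc s T) y = iteratedDerivWithin i g (Set.Icc 0 T) y := by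
  rw [iteratedDerivWithin, iteratedDerivWithin,
    iteratedFDerivWithin_subset (Set.Icc_subset_Icc_left hs) (uniqueDiffOn_Icc hsT)
      (uniqueDiffOn_Icc (hs.trans_lt hsT)) hg hy]

/-- Taylor's formula on `[0, T]` with a remainder that is uniform in the base point. -/
theorem exists_taylor_bound_Icc {g : ℝ → E} {T : ℝ} (hT : 0 < T) {m : ℕ}
    (hg : ContDiffOn ℝ (m + 1 : ℕ) g (Set.Icc 0 T)) :
    ∃ C : ℝ, 0 ≤ C ∧ ∀ s h : ℝ, 0 ≤ s → 0 ≤ h → s + h ≤ T →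
      ‖g (s + h) - ∑ i ∈ Finset.range (m + 1),
        (h ^ i / (i.factorial : ℝ)) • iteratedDerivWithin i g (Set.Icc 0 T) s‖ ≤
        C * h ^ (m + 1) := by
  obtain ⟨C, hC⟩ := isCompact_Icc.exists_bound_of_continuousOn
    (hg.continuousOn_iteratedDerivWithin le_rfl (uniqueDiffOn_Icc hT))
  have hC0 : 0 ≤ C := (norm_nonneg _).trans (hC 0 ⟨le_rfl, hT.le⟩)
  refine ⟨C, hC0, fun s h hs hh hsh => ?_⟩
  -- For $h=0$ the base point may be $T$, and then $[s,T]$ degenerates and carries no derivatives.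
  rcases hh.eq_or_lt with rfl | hh
  · rw [Finset.sum_range_succ']
    simp
  have hsT : s < T := by linarith
  have hsub : Set.Icc s T ⊆ Set.Icc 0 T := Set.Icc_subset_Icc_left hs
  have h1 := taylor_mean_remainder_bound (f := g) (a := s) (b := T) (C := C) (x := s + h) (n := m)
    hsT.le (by exact_mod_cast hg.mono hsub) ⟨by linarith, hsh⟩ fun y hy => by
      rw [iteratedDerivWithin_Icc_subset hs hsT hg hy]
      exact hC y (hsub hy)
  rw [taylor_within_apply, add_sub_cancel_left] at h1
  have h2 : ∑ i ∈ Finset.range (m + 1),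
      ((i.factorial : ℝ)⁻¹ * h ^ i) • iteratedDerivWithin i g (Set.Icc s T) s =
      ∑ i ∈ Finset.range (m + 1),
        (h ^ i / (i.factorial : ℝ)) • iteratedDerivWithin i g (Set.Icc 0 T) s := by
    refine Finset.sum_congr rfl fun i hi => ?_
    rw [iteratedDerivWithin_Icc_subset hs hsT (hg.of_le ?_) ⟨le_rfl, hsT.le⟩, inv_mul_eq_div]
    exact_mod_cast (Finset.mem_range.1 hi).le
  rw [h2] at h1
  refine h1.trans (div_le_self (by positivity) ?_)
  exact_mod_cast Nat.one_le_iff_ne_zero.2 (Nat.factorial_ne_zero m)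

/-- A linear combination of point values is determined by its moments up to `O(τ^{m+1})`. -/
theorem exists_quadrature_bound {g : ℝ → E} {T : ℝ} (hT : 0 < T) {m : ℕ}
    (hg : ContDiffOn ℝ (m + 1 : ℕ) g (Set.Icc 0 T)) (J : Finset ℕ) (q x : ℕ → ℝ)
    (hx : ∀ j ∈ J, 0 ≤ x j) :
    ∃ C : ℝ, 0 ≤ C ∧ ∀ s τ : ℝ, 0 ≤ s → 0 < τ → (∀ j ∈ J, s + x j * τ ≤ T) →
      ‖∑ j ∈ J, q j • g (s + x j * τ) - ∑ i ∈ Finset.range (m + 1),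
        ((∑ j ∈ J, q j * (x j * τ) ^ i) / (i.factorial : ℝ)) •
          iteratedDerivWithin i g (Set.Icc 0 T) s‖ ≤ C * τ ^ (m + 1) := by
  obtain ⟨C, hC0, hC⟩ := exists_taylor_bound_Icc hT hg
  refine ⟨∑ j ∈ J, |q j| * (C * x j ^ (m + 1)), Finset.sum_nonneg fun j hj => ?_, ?_⟩
  · have := hx j hj
    positivity
  intro s τ hs hτ hsT
  have h1 : ∑ i ∈ Finset.range (m + 1), ((∑ j ∈ J, q j * (x j * τ) ^ i) / (i.factorial : ℝ)) •
      iteratedDerivWithin i g (Set.Icc 0 T) s =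
      ∑ j ∈ J, q j • ∑ i ∈ Finset.range (m + 1), ((x j * τ) ^ i / (i.factorial : ℝ)) •
      iteratedDerivWithin i g (Set.Icc 0 T) s := by
    simp only [Finset.smul_sum, Finset.sum_div, Finset.sum_smul, smul_smul]
    rw [Finset.sum_comm]
    refine Finset.sum_congr rfl fun j _ => Finset.sum_congr rfl fun i _ => ?_
    rw [mul_div_assoc]
  rw [h1, ← Finset.sum_sub_distrib, Finset.sum_mul]
  refine norm_sum_le_of_le _ fun j hj => ?_
  rw [← smul_sub, norm_smul, Real.norm_eq_abs, mul_assoc]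
  refine mul_le_mul_of_nonneg_left ?_ (abs_nonneg _)
  refine (hC s (x j * τ) hs (mul_nonneg (hx j hj) hτ.le) (hsT j hj)).trans (le_of_eq ?_)
  rw [mul_pow]
  ring

namespace IEMS

variable {k : ℕ} {S : IEMS k}

/-- The order conditions are used at $n=k$, where nodes are measured from the oldest point
$t_{n-k}$; with $\ell=i+1$ the common factor $\ell$ cancels. -/
theorem OrderConditions.moment_b_eq_moment_c (h : S.OrderConditions k) {τ : ℝ} (hτ : 0 < τ) {i : ℕ}
    (hi : i < k) : ∑ j ∈ Finset.range (k + 1), S.b j * (((k : ℝ) - j) * τ) ^ i =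
      ∑ j ∈ Finset.range k, S.c j * (((k : ℝ) - j - 1) * τ) ^ i := by
  have h1 := h.implicit_part τ hτ k le_rfl (i + 1) (by omega) hi
  have h2 := h.explicit_part τ hτ k le_rfl (i + 1) (by omega) hi
  rw [h1] at h2
  have h3 : ((i + 1 : ℕ) : ℝ) ≠ 0 := by positivity
  exact mul_left_cancel₀ h3 h2

/-- Matches the Taylor term of degree $i+1$ of a function with the term of degree $i$ of its
derivative. -/
theorem OrderConditions.moment_a (h : S.OrderConditions k) {τ : ℝ} (hτ : 0 < τ) {i : ℕ}
    (hi : i < k) :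
    ((∑ j ∈ Finset.range k, S.a j * (((k : ℝ) - j) * τ) ^ (i + 1)) / ((i + 1).factorial : ℝ) -
      (∑ j ∈ Finset.range k, S.a j * (((k : ℝ) - j - 1) * τ) ^ (i + 1)) /
        ((i + 1).factorial : ℝ)) =
      τ * ((∑ j ∈ Finset.range (k + 1), S.b j * (((k : ℝ) - j) * τ) ^ i) /
        (i.factorial : ℝ)) := by
  have h1 := h.implicit_part τ hτ k le_rfl (i + 1) (by omega) hi
  rw [Nat.add_sub_cancel] at h1
  have h2 : ∑ j ∈ Finset.range k, S.a j * (((k : ℝ) - j) * τ) ^ (i + 1) -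
      ∑ j ∈ Finset.range k, S.a j * (((k : ℝ) - j - 1) * τ) ^ (i + 1) =
      τ * (((i + 1 : ℕ) : ℝ) * ∑ j ∈ Finset.range (k + 1), S.b j * (((k : ℝ) - j) * τ) ^ i) := by
    rw [← h1, ← Finset.sum_sub_distrib, Finset.mul_sum]
    refine Finset.sum_congr rfl fun j _ => ?_
    field_simp
  rw [← sub_div, h2, Nat.factorial_succ, Nat.cast_mul]
  have h3 : ((i + 1 : ℕ) : ℝ) ≠ 0 := by positivity
  have h4 : (i.factorial : ℝ) ≠ 0 := by positivity
  field_simp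

/-- The consistency error of the pair `(b, c)` of weights. -/
theorem OrderConditions.exists_extrapolation_bound (h : S.OrderConditions k) (hk : 1 ≤ k)
    {f : ℝ → E} {T : ℝ} (hT : 0 < T) (hf : ContDiffOn ℝ (k : ℕ) f (Set.Icc 0 T)) :
    ∃ C : ℝ, 0 ≤ C ∧ ∀ s τ : ℝ, 0 ≤ s → 0 < τ → s + k * τ ≤ T →
      ‖∑ j ∈ Finset.range (k + 1), S.b j • f (s + ((k : ℝ) - j) * τ) -
        ∑ j ∈ Finset.range k, S.c j • f (s + ((k : ℝ) - j - 1) * τ)‖ ≤ C * τ ^ k := by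
  obtain ⟨m, rfl⟩ : ∃ m, k = m + 1 := ⟨k - 1, by omega⟩
  obtain ⟨C₁, hC₁0, hC₁⟩ := exists_quadrature_bound hT hf (Finset.range (m + 1 + 1)) S.b
    (fun j => ((m + 1 : ℕ) : ℝ) - j) fun j hj => by
      have : (j : ℝ) ≤ ((m + 1 : ℕ) : ℝ) := by
        exact_mod_cast Nat.lt_succ_iff.1 (Finset.mem_range.1 hj)
      linarith
  obtain ⟨C₂, hC₂0, hC₂⟩ := exists_quadrature_bound hT hf (Finset.range (m + 1)) S.c
    (fun j => ((m + 1 : ℕ) : ℝ) - j - 1) fun j hj => by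
      have : (j : ℝ) + 1 ≤ ((m + 1 : ℕ) : ℝ) := by
        exact_mod_cast Finset.mem_range.1 hj
      linarith
  refine ⟨C₁ + C₂, by positivity, fun s τ hs hτ hsT => ?_⟩
  have hle : ∀ z : ℝ, z ≤ ((m + 1 : ℕ) : ℝ) → s + z * τ ≤ T := fun z hz => by nlinarith
  have h1 := hC₁ s τ hs hτ fun j _ => hle _ (by have : (0 : ℝ) ≤ j := j.cast_nonneg; linarith)
  have h2 := hC₂ s τ hs hτ fun j _ => hle _ (by have : (0 : ℝ) ≤ j := j.cast_nonneg; linarith)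
  have h3 : ∑ i ∈ Finset.range (m + 1), ((∑ j ∈ Finset.range (m + 1 + 1),
        S.b j * ((((m + 1 : ℕ) : ℝ) - j) * τ) ^ i) / (i.factorial : ℝ)) •
        iteratedDerivWithin i f (Set.Icc 0 T) s =
      ∑ i ∈ Finset.range (m + 1), ((∑ j ∈ Finset.range (m + 1),
        S.c j * ((((m + 1 : ℕ) : ℝ) - j - 1) * τ) ^ i) / (i.factorial : ℝ)) •
        iteratedDerivWithin i f (Set.Icc 0 T) s := by
    refine Finset.sum_congr rfl fun i hi => ?_
    rw [h.moment_b_eq_moment_c hτ (Finset.mem_range.1 hi)]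
  -- Both sums now share one Taylor polynomial at $s$, which cancels in their difference.
  rw [h3] at h1
  have h4 := norm_sub_le_of_le h1 h2
  rw [sub_sub_sub_cancel_right] at h4
  linarith

/-- The consistency error of the pair `(a, b)` of weights. -/
theorem OrderConditions.exists_derivative_bound (h : S.OrderConditions k) (hk : 1 ≤ k)
    {w : ℝ → E} {T : ℝ} (hT : 0 < T) (hw : ContDiffOn ℝ ((k + 1 : ℕ)) w (Set.Icc 0 T)) :
    ∃ C : ℝ, 0 ≤ C ∧ ∀ s τ : ℝ, 0 ≤ s → 0 < τ → s + k * τ ≤ T →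
      ‖∑ j ∈ Finset.range k,
          S.a j • (τ⁻¹ • (w (s + ((k : ℝ) - j) * τ) - w (s + ((k : ℝ) - j - 1) * τ))) -
        ∑ j ∈ Finset.range (k + 1),
          S.b j • derivWithin w (Set.Icc 0 T) (s + ((k : ℝ) - j) * τ)‖ ≤ C * τ ^ k := by
  have hw' : ContDiffOn ℝ (k : ℕ) (derivWithin w (Set.Icc 0 T)) (Set.Icc 0 T) :=
    hw.derivWithin (uniqueDiffOn_Icc hT) (by exact_mod_cast le_rfl)
  have hx₁ : ∀ j ∈ Finset.range (k + 1), 0 ≤ (k : ℝ) - j := fun j hj => by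
    have : (j : ℝ) ≤ k := by exact_mod_cast Nat.lt_succ_iff.1 (Finset.mem_range.1 hj)
    linarith
  have hx₂ : ∀ j ∈ Finset.range k, 0 ≤ (k : ℝ) - j - 1 := fun j hj => by
    have : (j : ℝ) + 1 ≤ k := by exact_mod_cast Finset.mem_range.1 hj
    linarith
  obtain ⟨C₁, hC₁0, hC₁⟩ := exists_quadrature_bound hT hw (Finset.range k) S.a
    (fun j => (k : ℝ) - j) fun j hj => by linarith [hx₂ j hj]
  obtain ⟨C₂, hC₂0, hC₂⟩ := exists_quadrature_bound hT hw (Finset.range k) S.a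
    (fun j => (k : ℝ) - j - 1) hx₂
  obtain ⟨C₃, hC₃0, hC₃⟩ : ∃ C : ℝ, 0 ≤ C ∧ ∀ s τ : ℝ, 0 ≤ s → 0 < τ →
      (∀ j ∈ Finset.range (k + 1), s + ((k : ℝ) - j) * τ ≤ T) →
      ‖∑ j ∈ Finset.range (k + 1),
          S.b j • derivWithin w (Set.Icc 0 T) (s + ((k : ℝ) - j) * τ) -
        ∑ i ∈ Finset.range k, ((∑ j ∈ Finset.range (k + 1), S.b j * (((k : ℝ) - j) * τ) ^ i) /
          (i.factorial : ℝ)) •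
          iteratedDerivWithin i (derivWithin w (Set.Icc 0 T)) (Set.Icc 0 T) s‖ ≤ C * τ ^ k := by
    obtain ⟨m, rfl⟩ : ∃ m, k = m + 1 := ⟨k - 1, by omega⟩
    exact exists_quadrature_bound hT hw' (Finset.range (m + 1 + 1)) S.b
      (fun j => ((m + 1 : ℕ) : ℝ) - j) hx₁
  refine ⟨C₁ + C₂ + C₃, by positivity, fun s τ hs hτ hsT => ?_⟩
  have hle : ∀ z : ℝ, z ≤ (k : ℝ) → s + z * τ ≤ T := fun z hz => by nlinarith
  have h1 := hC₁ s τ hs hτ fun j _ => hle _ (by have : (0 : ℝ) ≤ j := j.cast_nonneg; linarith)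
  have h2 := hC₂ s τ hs hτ fun j _ => hle _ (by have : (0 : ℝ) ≤ j := j.cast_nonneg; linarith)
  have h3 := hC₃ s τ hs hτ fun j _ => hle _ (by have : (0 : ℝ) ≤ j := j.cast_nonneg; linarith)
  set A₁ := ∑ j ∈ Finset.range k, S.a j • w (s + ((k : ℝ) - j) * τ) with hA₁
  set A₂ := ∑ j ∈ Finset.range k, S.a j • w (s + ((k : ℝ) - j - 1) * τ) with hA₂
  set A₃ := ∑ j ∈ Finset.range (k + 1),
          S.b j • derivWithin w (Set.Icc 0 T) (s + ((k : ℝ) - j) * τ) with hA₃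
  set P₁ := ∑ i ∈ Finset.range (k + 1),
    ((∑ j ∈ Finset.range k, S.a j * (((k : ℝ) - j) * τ) ^ i) / (i.factorial : ℝ)) •
      iteratedDerivWithin i w (Set.Icc 0 T) s with hP₁
  set P₂ := ∑ i ∈ Finset.range (k + 1),
    ((∑ j ∈ Finset.range k, S.a j * (((k : ℝ) - j - 1) * τ) ^ i) / (i.factorial : ℝ)) •
      iteratedDerivWithin i w (Set.Icc 0 T) s with hP₂
  set P₃ := ∑ i ∈ Finset.range k,
    ((∑ j ∈ Finset.range (k + 1), S.b j * (((k : ℝ) - j) * τ) ^ i) / (i.factorial : ℝ)) •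
      iteratedDerivWithin i (derivWithin w (Set.Icc 0 T)) (Set.Icc 0 T) s with hP₃
  -- The constant terms cancel, and the others match by the moments of $a$. The remainders of `A₁`
  -- and `A₂` are $O(\tau^{k+1})$, which pays for the division by $\tau$.
  have hP : P₁ - P₂ = τ • P₃ := by
    rw [hP₁, hP₂, hP₃, ← Finset.sum_sub_distrib, Finset.sum_range_succ', Finset.smul_sum]
    simp only [pow_zero, sub_self, add_zero]
    refine Finset.sum_congr rfl fun i hi => ?_
    rw [← sub_smul, h.moment_a hτ (Finset.mem_range.1 hi), smul_smul, iteratedDerivWithin_succ']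
  have hA : ∑ j ∈ Finset.range k,
      S.a j • (τ⁻¹ • (w (s + ((k : ℝ) - j) * τ) - w (s + ((k : ℝ) - j - 1) * τ))) =
      τ⁻¹ • (A₁ - A₂) := by
    rw [hA₁, hA₂, ← Finset.sum_sub_distrib, Finset.smul_sum]
    refine Finset.sum_congr rfl fun j _ => ?_
    rw [← smul_sub, smul_comm]
  have hid : τ⁻¹ • (A₁ - A₂) - A₃ = τ⁻¹ • ((A₁ - P₁) - (A₂ - P₂)) - (A₃ - P₃) := by
    have : (A₁ - P₁) - (A₂ - P₂) = (A₁ - A₂) - τ • P₃ := by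
      rw [← hP]
      abel
    rw [this, smul_sub τ⁻¹ (A₁ - A₂), smul_smul, inv_mul_cancel₀ hτ.ne', one_smul]
    abel
  rw [hA, hid]
  have h4 := norm_sub_le_of_le h1 h2
  have h5 : ‖τ⁻¹ • ((A₁ - P₁) - (A₂ - P₂))‖ ≤ (C₁ + C₂) * τ ^ k := by
    rw [norm_smul, Real.norm_of_nonneg (by positivity), inv_mul_le_iff₀ hτ]
    refine h4.trans (le_of_eq ?_)
    ring
  refine (norm_sub_le_of_le h5 h3).trans (le_of_eq ?_)
  ring

end IEMS

end Consistency

/-! ### Consistency of the solution and the main theorem -/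

section Main

variable {V H : Type*} [NormedAddCommGroup V] [InnerProductSpace ℝ V]
  [NormedAddCommGroup H] [InnerProductSpace ℝ H] {ι : V →L[ℝ] H} {L : V →L[ℝ] StrongDual ℝ V}
  {F : V → StrongDual ℝ V} {ϖ T μ₀ μ₁ : ℝ} {k : ℕ} {u : ℝ → V} {S : IEMS k}

/-- Continuity of $\mathcal F$ is not assumed; along the solution it follows from the Lipschitz
condition in the ball around $u(t_0)$. It allows the differential equation to be extended to the end
points. -/
theorem LocalLipschitz.continuousOn_comp (hF : LocalLipschitz ι L F u T μ₀ μ₁)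
    (hL : IsPosDefSelfAdjoint L) (hu : ContinuousOn u (Set.Icc 0 T)) :
    ContinuousOn (fun t => F (u t)) (Set.Icc 0 T) := by
  intro t₀ ht₀
  have h1 : Filter.Tendsto (fun t => u t - u t₀) (nhdsWithin t₀ (Set.Icc 0 T)) (nhds 0) := by
    have := (hu t₀ ht₀).tendsto.sub_const (u t₀)
    rwa [sub_self] at this
  have h2 : Filter.Tendsto (fun t => energyNorm L (u t - u t₀))
      (nhdsWithin t₀ (Set.Icc 0 T)) (nhds 0) := by
    refine squeeze_zero (fun t => energyNorm_nonneg L _) (fun t => energyNorm_le_norm L _) ?_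
    simpa using h1.norm.const_mul (Real.sqrt ‖L‖)
  have h3 : Filter.Tendsto (fun t => ‖ι (u t - u t₀)‖)
      (nhdsWithin t₀ (Set.Icc 0 T)) (nhds 0) := by
    simpa using ((ι.continuous.tendsto 0).comp h1).norm
  have h4 : Filter.Tendsto (fun t => Real.sqrt ‖L‖ *
      (μ₀ * energyNorm L (u t - u t₀) + μ₁ * ‖ι (u t - u t₀)‖))
      (nhdsWithin t₀ (Set.Icc 0 T)) (nhds 0) := by
    simpa using ((h2.const_mul μ₀).add (h3.const_mul μ₁)).const_mul (Real.sqrt ‖L‖)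
  refine tendsto_iff_norm_sub_tendsto_zero.2 (squeeze_zero' (Filter.Eventually.of_forall
    fun t => norm_nonneg _) ?_ h4)
  filter_upwards [h2.eventually (ge_mem_nhds one_pos)] with t ht
  refine (hL.norm_le_dualNorm _).trans (mul_le_mul_of_nonneg_left ?_ (Real.sqrt_nonneg _))
  refine hF t₀ ht₀ (u t) (u t₀) ht ?_
  rw [sub_self, energyNorm_zero]
  exact zero_le_one

/-- The differential equation holds up to the end points, with one-sided derivatives. -/
theorem IsRegularSolution.equation_Icc (hu : IsRegularSolution ι L F ϖ T k u)
    (hL : IsPosDefSelfAdjoint L) (hF : LocalLipschitz ι L F u T μ₀ μ₁) (hT : 0 < T) :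
    Set.EqOn (fun t => F (u t))
      (fun t => derivWithin (fun s => toDualV ι (u s)) (Set.Icc 0 T) t + ϖ • L (u t))
      (Set.Icc 0 T) := by
  have hcu := hu.regular_V.continuousOn
  have h1 : Set.EqOn (fun t => F (u t))
      (fun t => derivWithin (fun s => toDualV ι (u s)) (Set.Icc 0 T) t + ϖ • L (u t))
      (Set.Ioo 0 T) := by
    intro t ht
    simp only
    rw [(hu.equation t ht).hasDerivWithinAt.derivWithin
      (uniqueDiffOn_Icc hT t (Set.Ioo_subset_Icc_self ht)), sub_add_cancel]
  refine h1.of_subset_closure (hF.continuousOn_comp hL hcu) ?_ Set.Ioo_subset_Icc_self ?_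
  · refine ContinuousOn.add ?_ ((L.continuous.comp_continuousOn hcu).const_smul ϖ)
    exact hu.regular_dual.continuousOn_derivWithin (uniqueDiffOn_Icc hT)
      (by exact_mod_cast Nat.succ_le_succ (Nat.zero_le k))
  · rw [closure_Ioo hT.ne]

/-- Consistency of order `k` in the steps `n ≥ k`. -/
theorem IEMS.OrderConditions.exists_residual_bound (h : S.OrderConditions k) (hk : 1 ≤ k)
    (hL : IsPosDefSelfAdjoint L) (hu : IsRegularSolution ι L F ϖ T k u)
    (hF : LocalLipschitz ι L F u T μ₀ μ₁) (hT : 0 < T) :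
    ∃ C : ℝ, 0 ≤ C ∧ ∀ (τ : ℝ) (n : ℕ) (corr : ℕ → StrongDual ℝ V), 0 < τ → k ≤ n → n * τ ≤ T →
      dualNorm L (S.residual ι L F ϖ τ corr (fun m => u (m * τ)) n) ≤ C * τ ^ k := by
  set w : ℝ → StrongDual ℝ V := fun s => toDualV ι (u s) with hw
  set f : ℝ → StrongDual ℝ V := fun t => derivWithin w (Set.Icc 0 T) t + ϖ • L (u t) with hf
  have hEq : Set.EqOn (fun t => F (u t)) f (Set.Icc 0 T) := hu.equation_Icc hL hF hT
  have hfreg : ContDiffOn ℝ (k : ℕ) f (Set.Icc 0 T) := by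
    refine ContDiffOn.add ?_ ((L.contDiff.comp_contDiffOn hu.regular_V).const_smul ϖ)
    exact hu.regular_dual.derivWithin (uniqueDiffOn_Icc hT) (by exact_mod_cast le_rfl)
  obtain ⟨C₁, hC₁0, hC₁⟩ := h.exists_derivative_bound hk hT hu.regular_dual
  obtain ⟨C₂, hC₂0, hC₂⟩ := h.exists_extrapolation_bound hk hT hfreg
  obtain ⟨C₃, hC₃0, hC₃⟩ := hL.exists_dualNorm_le
  refine ⟨C₃ * (C₁ + C₂), by positivity, fun τ n corr hτ hkn hnT => ?_⟩
  have hnk : (k : ℝ) ≤ n := by exact_mod_cast hkn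
  set s : ℝ := ((n : ℝ) - k) * τ with hs
  have hs0 : 0 ≤ s := mul_nonneg (by linarith) hτ.le
  have hsT : s + k * τ ≤ T := by
    have : s + k * τ = n * τ := by rw [hs]; ring
    rw [this]
    exact hnT
  have hn1 : ∀ j ∈ Finset.range (k + 1), ((n - j : ℕ) : ℝ) * τ = s + ((k : ℝ) - j) * τ := by
    intro j hj
    have : j ≤ n := by
      have := Finset.mem_range.1 hj
      omega
    rw [Nat.cast_sub this, hs]
    ring
  have hn2 : ∀ j ∈ Finset.range k,
      ((n - j - 1 : ℕ) : ℝ) * τ = s + ((k : ℝ) - j - 1) * τ := by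
    intro j hj
    have : j + 1 ≤ n := by
      have := Finset.mem_range.1 hj
      omega
    rw [Nat.sub_sub, Nat.cast_sub this, hs]
    push_cast
    ring
  have hmem : ∀ j ∈ Finset.range k, s + ((k : ℝ) - j - 1) * τ ∈ Set.Icc 0 T := by
    intro j hj
    have h1 : (j : ℝ) + 1 ≤ k := by exact_mod_cast Finset.mem_range.1 hj
    have h2 : (0 : ℝ) ≤ j := j.cast_nonneg
    have h3 : 0 ≤ ((k : ℝ) - j - 1) * τ := mul_nonneg (by linarith) hτ.le
    have h4 : ((k : ℝ) - j - 1) * τ ≤ k * τ := mul_le_mul_of_nonneg_right (by linarith) hτ.le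
    exact ⟨by linarith, by linarith⟩
  -- The sum $\sum_jb_ju_t(t_{n-j})$ is subtracted and added, and $u_t+\varpi\mathcal Lu=f=\mathcal
  -- F(u)$ is used. The residual splits into the errors of the pairs $(a,b)$ and $(b,c)$.
  have hres : S.residual ι L F ϖ τ corr (fun m => u (m * τ)) n =
      (∑ j ∈ Finset.range k,
          S.a j • (τ⁻¹ • (w (s + ((k : ℝ) - j) * τ) - w (s + ((k : ℝ) - j - 1) * τ))) -
        ∑ j ∈ Finset.range (k + 1),
          S.b j • derivWithin w (Set.Icc 0 T) (s + ((k : ℝ) - j) * τ)) +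
      (∑ j ∈ Finset.range (k + 1), S.b j • f (s + ((k : ℝ) - j) * τ) -
        ∑ j ∈ Finset.range k, S.c j • f (s + ((k : ℝ) - j - 1) * τ)) := by
    have e1 : (Finset.range k).filter (fun j => j < n) = Finset.range k :=
      Finset.filter_true_of_mem fun j hj => (Finset.mem_range.1 hj).trans_le hkn
    have e2 : (Finset.range (k + 1)).filter (fun j => j ≤ n) = Finset.range (k + 1) :=
      Finset.filter_true_of_mem fun j hj => (Nat.lt_succ_iff.1 (Finset.mem_range.1 hj)).trans hkn
    have e3 : ∑ j ∈ Finset.range (k + 1), S.b j • f (s + ((k : ℝ) - j) * τ) =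
        ∑ j ∈ Finset.range (k + 1),
          S.b j • derivWithin w (Set.Icc 0 T) (s + ((k : ℝ) - j) * τ) +
        ϖ • ∑ j ∈ Finset.range (k + 1), S.b j • L (u (((n - j : ℕ) : ℝ) * τ)) := by
      rw [Finset.smul_sum, ← Finset.sum_add_distrib]
      refine Finset.sum_congr rfl fun j hj => ?_
      rw [hn1 j hj, hf, smul_comm ϖ, ← smul_add]
    have e4 : ∑ j ∈ Finset.range k, S.c j • F (u (((n - j - 1 : ℕ) : ℝ) * τ)) =
        ∑ j ∈ Finset.range k, S.c j • f (s + ((k : ℝ) - j - 1) * τ) := by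
      refine Finset.sum_congr rfl fun j hj => ?_
      rw [hn2 j hj, ← hEq (hmem j hj)]
    have e5 : ∑ j ∈ Finset.range k, S.a j • (τ⁻¹ • (toDualV ι (u (((n - j : ℕ) : ℝ) * τ)) -
          toDualV ι (u (((n - j - 1 : ℕ) : ℝ) * τ)))) =
        ∑ j ∈ Finset.range k,
          S.a j • (τ⁻¹ • (w (s + ((k : ℝ) - j) * τ) - w (s + ((k : ℝ) - j - 1) * τ))) := by
      refine Finset.sum_congr rfl fun j hj => ?_
      rw [hn2 j hj, hn1 j (Finset.mem_range.2 ((Finset.mem_range.1 hj).trans (Nat.lt_succ_self k)))]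
    unfold IEMS.residual
    rw [e1, e2, if_neg (not_lt.2 hkn), e3, e4, e5]
    abel
  rw [hres, mul_assoc]
  refine (hC₃ _).trans (mul_le_mul_of_nonneg_left ?_ hC₃0.le)
  rw [add_mul]
  exact norm_add_le_of_le (hC₁ s τ hs0 hτ hsT) (hC₂ s τ hs0 hτ hsT)

/-- A single summand of the energy is isolated, at the price of dividing by $\tau$. The sum starts
at $1$, so $n=0$ must be treated separately. -/
theorem energyNorm_le_half_of_discreteEnergy_le {ε lamI τ B : ℝ}
    {e : ℕ → V} {n : ℕ} (hn : 1 ≤ n) (hc : 0 < ε * lamI * ϖ) (hτ : 0 < τ)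
    (h : discreteEnergy ι L ε lamI ϖ τ e n ≤ B) (hB : B ≤ ε * lamI * ϖ / 4 * τ) :
    energyNorm L (e n) ≤ 1 / 2 := by
  have h1 : τ * energyNorm L (e n) ^ 2 ≤ ∑ j ∈ Finset.Icc 1 n, τ * energyNorm L (e j) ^ 2 :=
    Finset.single_le_sum (f := fun j => τ * energyNorm L (e j) ^ 2)
      (fun j _ => by positivity) (Finset.mem_Icc.2 ⟨hn, le_rfl⟩)
  have h2 := mul_le_mul_of_nonneg_left h1 hc.le
  have h3 : ε * lamI * ϖ * (τ * energyNorm L (e n) ^ 2) ≤ ε * lamI * ϖ / 4 * τ := by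
    unfold discreteEnergy at h
    have : 0 ≤ ‖ι (e n)‖ ^ 2 := by positivity
    linarith
  have h4 : ε * lamI * ϖ * τ * energyNorm L (e n) ^ 2 ≤ ε * lamI * ϖ * τ * (1 / 2) ^ 2 := by
    linarith
  have h5 := le_of_mul_le_mul_left h4 (by positivity)
  exact le_of_sq_le_sq h5 (by norm_num)

theorem perturbationSize_mono {τ : ℝ} (hτ : 0 < τ) (e0 : V) (d : ℕ → StrongDual ℝ V) {n N : ℕ}
    (hn : n ≤ N) : perturbationSize ι L τ e0 d n ≤ perturbationSize ι L τ e0 d N := by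
  unfold perturbationSize
  refine add_le_add_right (Finset.sum_le_sum_of_subset_of_nonneg
    (Finset.Icc_subset_Icc_right hn) fun i _ _ => by positivity) _

end Main

theorem mainTheorem1
    {V H : Type*} [NormedAddCommGroup V] [InnerProductSpace ℝ V] [CompleteSpace V]
    [NormedAddCommGroup H] [InnerProductSpace ℝ H] [CompleteSpace H]
    (ι : V →L[ℝ] H) (_hι_inj : Function.Injective ι) (_hι_dense : DenseRange ι)
    (L : V →L[ℝ] StrongDual ℝ V) (_hL : IsPosDefSelfAdjoint L)
    (F : V → StrongDual ℝ V) (ϖ T : ℝ) (_hϖ : 0 < ϖ) (_hT : 0 < T)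
    (k : ℕ) (_hk : 1 ≤ k)
    (u : ℝ → V) (_hu : IsRegularSolution ι L F ϖ T k u)
    (μ₀ μ₁ : ℝ) (_hμ₀ : 0 ≤ μ₀) (_hF : LocalLipschitz ι L F u T μ₀ μ₁)
    (S : IEMS k) (_hzero : S.ZeroStable) (_horder : S.OrderConditions k)
    (σF σE lamI : ℝ) (_hS : S.HasIntensities σF σE lamI)
    (_hstab : lamI / σE > μ₀ / ϖ)
    -- the constant in the consistency of order `k` of the corrected starting steps
    (Kc : ℝ) :
    0 < stabilityMargin ϖ μ₀ σE lamI ∧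
    ∃ K τ₀ δ : ℝ, 0 < K ∧ 0 < τ₀ ∧ 0 < δ ∧
      ∀ (N : ℕ) (τ : ℝ), 1 ≤ N → τ = T / N → τ ≤ τ₀ →
      ∀ corr : ℕ → StrongDual ℝ V,
      (∀ n : ℕ, 1 ≤ n → n < k → n ≤ N →
        dualNorm L (S.residual ι L F ϖ τ corr (fun m => u (m * τ)) n) ≤ Kc * τ ^ k) →
      ∀ U : ℕ → V, U 0 = u 0 →
      (∀ n : ℕ, 1 ≤ n → n ≤ N → S.residual ι L F ϖ τ corr U n = 0) →
      -- stability: the errors stay in the unit ball of `V`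
      (∀ n : ℕ, n ≤ N → energyNorm L (u (n * τ) - U n) ≤ 1) ∧
      -- stability: the numerical solution depends continuously on perturbations
      (∀ (v : ℕ → V) (d : ℕ → StrongDual ℝ V),
        (∀ n : ℕ, 1 ≤ n → n ≤ N → S.residual ι L F ϖ τ corr v n = d n) →
        perturbationSize ι L τ (v 0 - U 0) d N ≤ δ * τ →
        ∀ n : ℕ, n ≤ N →
          energyNorm L (u (n * τ) - v n) ≤ 1 ∧
          discreteEnergy ι L (stabilityMargin ϖ μ₀ σE lamI) lamI ϖ τ (fun j => v j - U j) n
            ≤ K * perturbationSize ι L τ (v 0 - U 0) d n) ∧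
      -- convergence of order `k`
      (∀ n : ℕ, n ≤ N →
        discreteEnergy ι L (stabilityMargin ϖ μ₀ σE lamI) lamI ϖ τ
            (fun j => u (j * τ) - U j) n
          ≤ K * τ ^ (2 * k)) := by
  have hϖ := _hϖ
  have hT := _hT
  have hlam := _hS.I_pos
  have hε0 : 0 < stabilityMargin ϖ μ₀ σE lamI :=
    stabilityMargin_pos hϖ _hμ₀ _hS.E_pos hlam _hstab
  refine ⟨hε0, ?_⟩
  set ε := stabilityMargin ϖ μ₀ σE lamI with hε
  obtain ⟨K₀, hK₀, hstable⟩ := IEMS.exists_stability_constant (ι := ι) (S := S) _hL F hϖ _hk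
    (μ := |μ₁|) _hμ₀ _hzero _hS _hstab
  obtain ⟨C₀, hC₀, hcons⟩ := _horder.exists_residual_bound _hk _hL _hu _hF hT
  -- The absolute value is taken because `Kc` may be negative.
  set C := C₀ + |Kc| with hC
  have hC0 : 0 ≤ C := by positivity
  have hc : 0 < ε * lamI * ϖ := by positivity
  set K := K₀ + K₀ * (T * C ^ 2) with hK
  have hK0 : 0 < K := by positivity
  -- Both thresholds force the energy below $\frac14\varepsilon\lambda_I\varpi\tau$, hence
  -- $V$-errors below $\frac12$. The extra $\frac14$ in `δ` controls the initial perturbation, whose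
  -- $V$-norm is not part of the discrete energy.
  refine ⟨K, min 1 (ε * lamI * ϖ / 4 / K), min (1 / 4) (ε * lamI * ϖ / 4 / K), hK0, by positivity,
    by positivity, ?_⟩
  intro N τ hN hτN hττ₀ corr hcorr U hU0 hU
  have hN0 : (0 : ℝ) < N := by exact_mod_cast hN
  have hτ : 0 < τ := by rw [hτN]; positivity
  have hNT : N * τ = T := by rw [hτN]; field_simp
  have hτ1 : τ ≤ 1 := hττ₀.trans (min_le_left _ _)
  have hKτ : K * τ ≤ ε * lamI * ϖ / 4 := by
    rw [mul_comm, ← le_div_iff₀ hK0]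
    exact hττ₀.trans (min_le_right _ _)
  have hnT : ∀ n ≤ N, (n : ℝ) * τ ≤ T := by
    intro n hn
    rw [← hNT]
    exact mul_le_mul_of_nonneg_right (by exact_mod_cast hn) hτ.le
  have hmem : ∀ n ≤ N, (n : ℝ) * τ ∈ Set.Icc 0 T := fun n hn => ⟨by positivity, hnT n hn⟩
  have hLip : ∀ t ∈ Set.Icc (0 : ℝ) T, ∀ v w : V, energyNorm L (v - u t) ≤ 1 →
      energyNorm L (w - u t) ≤ 1 →
      dualNorm L (F v - F w) ≤ μ₀ * energyNorm L (v - w) + |μ₁| * ‖ι (v - w)‖ := by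
    intro t ht v w hv hw
    have h1 := mul_le_mul_of_nonneg_right (le_abs_self μ₁) (norm_nonneg (ι (v - w)))
    exact (_hF t ht v w hv hw).trans (by linarith)
  set d : ℕ → StrongDual ℝ V := S.residual ι L F ϖ τ corr (fun m => u (m * τ)) with hd
  have hdn : ∀ n, 1 ≤ n → n ≤ N → dualNorm L (d n) ≤ C * τ ^ k := by
    intro n hn1 hn
    have hτk : 0 ≤ τ ^ k := by positivity
    by_cases hkn : k ≤ n
    · refine (hcons τ n corr hτ hkn (hnT n hn)).trans (mul_le_mul_of_nonneg_right ?_ hτk)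
      linarith [abs_nonneg Kc]
    · refine (hcorr n hn1 (not_le.1 hkn) hn).trans (mul_le_mul_of_nonneg_right ?_ hτk)
      linarith [le_abs_self Kc]
  have hu0 : u (((0 : ℕ) : ℝ) * τ) - U 0 = 0 := by simp [hU0]
  have hP : ∀ n ≤ N, perturbationSize ι L τ (u (((0 : ℕ) : ℝ) * τ) - U 0) d n ≤
      T * C ^ 2 * τ ^ (2 * k) := by
    intro n hn
    rw [hu0, perturbationSize, map_zero, norm_zero, energyNorm_zero]
    have h1 : ∑ i ∈ Finset.Icc 1 n, τ * dualNorm L (d i) ^ 2 ≤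
        ∑ _i ∈ Finset.Icc 1 n, τ * (C * τ ^ k) ^ 2 := by
      refine Finset.sum_le_sum fun i hi => ?_
      rw [Finset.mem_Icc] at hi
      have h2 := hdn i hi.1 (hi.2.trans hn)
      have h3 := dualNorm_nonneg L (d i)
      gcongr
    rw [Finset.sum_const, Nat.card_Icc, Nat.add_sub_cancel, nsmul_eq_mul] at h1
    have h2 : (n : ℝ) * (τ * (C * τ ^ k) ^ 2) = n * τ * (C * τ ^ k) ^ 2 := by ring
    have h3 := mul_le_mul_of_nonneg_right (hnT n hn) (sq_nonneg (C * τ ^ k))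
    have h4 : T * C ^ 2 * τ ^ (2 * k) = T * (C * τ ^ k) ^ 2 := by ring
    rw [h4]
    linarith
  have hconv : ∀ n ≤ N, (∀ j < n, energyNorm L (u (j * τ) - U j) ≤ 1) →
      discreteEnergy ι L ε lamI ϖ τ (fun j => u (j * τ) - U j) n ≤ K * τ ^ (2 * k) := by
    intro n hn hball
    have h1 := hstable τ n hτ (hnT n hn) corr (fun m => u (m * τ)) U d (fun j hj => ?_)
      (fun j hj1 hj => by rw [hU j hj1 (hj.trans hn), sub_zero])
    · refine h1.trans ((mul_le_mul_of_nonneg_left (hP n hn) hK₀.le).trans ?_)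
      rw [← mul_assoc]
      refine mul_le_mul_of_nonneg_right ?_ (by positivity)
      linarith
    · refine hLip _ (hmem j (hj.le.trans hn)) _ _ ?_ ?_
      · rw [sub_self, energyNorm_zero]
        exact zero_le_one
      · rw [energyNorm_sub_comm]
        exact hball j hj
  -- Since $2k\ge2$ and $\tau\le1$, one power of $\tau$ remains after the division by $\tau$, and it
  -- supplies the smallness.
  have hτk : K * τ ^ (2 * k) ≤ ε * lamI * ϖ / 4 * τ := by
    have h1 : τ ^ (2 * k) ≤ τ ^ 2 := pow_le_pow_of_le_one hτ.le hτ1 (by omega)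
    calc K * τ ^ (2 * k) ≤ K * τ ^ 2 := mul_le_mul_of_nonneg_left h1 hK0.le
      _ = K * τ * τ := by ring
      _ ≤ _ := mul_le_mul_of_nonneg_right hKτ hτ.le
  -- The radius $\frac12$ rather than $1$ leaves room for the perturbation: $u-v=(u-U)+(U-v)$ must
  -- stay in the unit ball.
  have hball : ∀ n ≤ N, energyNorm L (u (n * τ) - U n) ≤ 1 / 2 := by
    intro n
    induction n using Nat.strong_induction_on with
    | _ n ih =>
      intro hn
      rcases Nat.eq_zero_or_pos n with rfl | hn1
      · rw [hu0, energyNorm_zero]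
        norm_num
      · refine energyNorm_le_half_of_discreteEnergy_le (e := fun j => u (j * τ) - U j) hn1 hc
          hτ (hconv n hn fun j hj => ?_) hτk
        exact (ih j hj (hj.le.trans hn)).trans (by norm_num)
  refine ⟨fun n hn => (hball n hn).trans (by norm_num), ?_, fun n hn => hconv n hn fun j hj =>
    (hball j (hj.le.trans hn)).trans (by norm_num)⟩
  intro v d' hv hPN
  have hK₀K : K₀ ≤ K := by
    have : 0 ≤ K₀ * (T * C ^ 2) := by positivity
    linarith
  have hPnn : ∀ n, 0 ≤ perturbationSize ι L τ (v 0 - U 0) d' n := fun n =>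
    add_nonneg (by positivity) (Finset.sum_nonneg fun i _ => by positivity)
  have hsum : ∀ n ≤ N, energyNorm L (v n - U n) ≤ 1 / 2 → energyNorm L (u (n * τ) - v n) ≤ 1 := by
    intro n hn h1
    have h2 : u (n * τ) - v n = (u (n * τ) - U n) + (U n - v n) := by abel
    rw [h2]
    refine _hL.energyNorm_add_le (hball n hn) ?_
    rw [energyNorm_sub_comm]
    exact h1
  have hdep : ∀ n ≤ N, (∀ j < n, energyNorm L (v j - U j) ≤ 1 / 2) →
      discreteEnergy ι L ε lamI ϖ τ (fun j => v j - U j) n ≤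
        K * perturbationSize ι L τ (v 0 - U 0) d' n := by
    intro n hn hj2
    have h1 := hstable τ n hτ (hnT n hn) corr v U d' (fun j hj => ?_)
      (fun j hj1 hj => by rw [hU j hj1 (hj.trans hn), sub_zero, hv j hj1 (hj.trans hn)])
    · exact h1.trans (mul_le_mul_of_nonneg_right hK₀K (hPnn n))
    · have hjN := hj.le.trans hn
      refine hLip _ (hmem j hjN) _ _ ?_ ?_
      · rw [energyNorm_sub_comm]
        exact hsum j hjN (hj2 j hj)
      · rw [energyNorm_sub_comm]
        exact (hball j hjN).trans (by norm_num)
  -- The same induction as for the exact solution, with the smallness now supplied by the bound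
  -- $P_N\le\delta\tau$.
  have hhalf : ∀ n ≤ N, energyNorm L (v n - U n) ≤ 1 / 2 := by
    intro n
    induction n using Nat.strong_induction_on with
    | _ n ih =>
      intro hn
      rcases Nat.eq_zero_or_pos n with rfl | hn1
      · have h1 : τ * energyNorm L (v 0 - U 0) ^ 2 ≤ τ * (1 / 4) := by
          have h2 : τ * energyNorm L (v 0 - U 0) ^ 2 ≤
              perturbationSize ι L τ (v 0 - U 0) d' N := by
            unfold perturbationSize
            have h3 : 0 ≤ ∑ i ∈ Finset.Icc 1 N, τ * dualNorm L (d' i) ^ 2 :=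
              Finset.sum_nonneg fun i _ => by positivity
            have h4 : 0 ≤ ‖ι (v 0 - U 0)‖ ^ 2 := by positivity
            linarith
          rw [mul_comm τ (1 / 4)]
          exact (h2.trans hPN).trans (mul_le_mul_of_nonneg_right (min_le_left _ _) hτ.le)
        have h2 := le_of_mul_le_mul_left h1 hτ
        exact le_of_sq_le_sq (h2.trans (by norm_num)) (by norm_num)
      · refine energyNorm_le_half_of_discreteEnergy_le (e := fun j => v j - U j) hn1 hc hτ
          (hdep n hn fun j hj => ih j hj (hj.le.trans hn)) ?_
        have h1 := (perturbationSize_mono (ι := ι) (L := L) hτ (v 0 - U 0) d' hn).trans hPN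
        have h2 : min (1 / 4) (ε * lamI * ϖ / 4 / K) ≤ ε * lamI * ϖ / 4 / K := min_le_right _ _
        calc K * perturbationSize ι L τ (v 0 - U 0) d' n
            ≤ K * (ε * lamI * ϖ / 4 / K * τ) :=
              mul_le_mul_of_nonneg_left
                (h1.trans (mul_le_mul_of_nonneg_right h2 hτ.le)) hK0.le
          _ = ε * lamI * ϖ / 4 * τ := by field_simp
  exact fun n hn => ⟨hsum n hn (hhalf n hn), hdep n hn fun j hj => hhalf j (hj.le.trans hn)⟩
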